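/- **Definitions.** A *prudent walk* is a nearest-neighbour walk on $\mathbb{Z}^2$ starting at $(0,0)$ in which no step points towards an already visited vertex. The *box* of a walk is its minimal bounding rectangle. A prudent walk is *three-sided* if every step ends on the left, top or right side of the current box and every left or right step that ends on the bottom side of the current box inflates the box. A *generic three-sided prudent polygon* (ending on the right) is a three-sided prudent walk that ends in $(1,0)$ and reaches it from $(1,1)$; its perimeter is the number of steps plus one (the closing edge). Let $R(t,u,w)$ be the generating function of these polygons counted by half-perimeter ($t$), length of the top row ($u$) and distance of the top left corner of the top row from the top left corner of the box ($w$). A *bar graph* is a finite non-empty sequence of adjacent columns of positive heights standing on a common line; let $B(t,u)$ be the generating function of bar graphs counted by half-perimeter ($t$) and width ($u$). **Theorem.** The functional equation $$ \begin{aligned} F(t,u,w)={}&ut\,(B(t,u)+t)+\frac{ut\,(F(t,w,w)-F(t,u,w))}{w-u}\\ &+\frac{ut^2\,(F(t,u,w)-F(t,u,ut))}{w-ut}+F(t,u,ut)\,ut\,(B(t,u)+t) \end{aligned} $$ has a unique formal power series solution $F\in\mathbb{Q}[[t,u,w]]$, namely $F=R$, and for every $n$ the coefficient of $t^n$ in $R$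 is a polynomial in $u,w$. The series $R(t,w,w)$ is the generating function of generic three-sided prudent polygons counted by half-perimeter ($t$) and width of the box ($w$), and, as an infinite sum of formal power series converging $t$-adically, $$ R(t,w,w)=\sum_{k\ge 0}L\big((tq^2)^k w\big)\prod_{j=0}^{k-1}K\big((tq^2)^j w\big), \qquad q=\frac{t^2+1-\sqrt{1-4t+2t^2+t^4}}{2t}, $$ where $$ K(w)=\frac{(1-t)q-1-\big((1-t+t^2)q-1\big)\big(B(t,qw)+t\big)w}{1-t(1+t)q-\big(t(1-t-t^3)q+t^2\big)\big(B(t,qw)+t\big)w}, $$ $$ L(w)=\frac{\big(1+t^2-(1-2t+2t^2+t^4)q\big)\big(B(t,qw)+t\big)w}{1-t(1+t)q-\big(t(1-t-t^3)q+t^2\big)\big(B(t,qw)+t\big)w}, $$ and $$ B(t,u)=\frac{1-t-u(1+t)t-\sqrt{t^2(1-t)^2u^2-2t(1-t^2)u+(1-t)^2}}{2tu}. $$ Both square roots are the power series with constant term $1$. -/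

import Mathlib

namespace PrudentPolygons

/-! ### Walks on the square lattice -/

/-- The four unit steps of the square lattice. -/
inductive Step
  | left
  | right
  | up
  | down
  deriving DecidableEq

instance : Fintype Step :=
  ⟨{.left, .right, .up, .down}, fun s => by cases s <;> simp⟩

/-- The displacement of a step. -/
def Step.vec : Step → ℤ × ℤ
  | .left => (-1, 0)
  | .right => (1, 0)
  | .up => (0, 1)
  | .down => (0, -1)

/-- The vertex reached after the first `i` steps of the walk `p`, which starts at the origin.
The vertices of the walk are `pos p 0, …, pos p p.length`. -/
def pos (p : List Step) (i : ℕ) : ℤ × ℤ := ((p.take i).map Step.vec).sum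

/-- A walk is prudent if no step points towards an already occupied vertex: no vertex visited so
far lies on the open ray that starts at the current vertex in the direction of the next step. -/
def IsPrudent (p : List Step) : Prop :=
  ∀ (i : ℕ) (hi : i < p.length), ∀ j ≤ i, ∀ m : ℕ, 1 ≤ m →
    pos p j ≠ pos p i + m • (p[i]).vec

/-- After `k` steps the walk is on the left side of its current box
(the bounding rectangle of `pos p 0, …, pos p k`). -/
def OnLeft (p : List Step) (k : ℕ) : Prop := ∀ j ≤ k, (pos p k).1 ≤ (pos p j).1

/-- After `k` steps the walk is on the right side of its current box. -/
def OnRight (p : List Step) (k : ℕ) : Prop := ∀ j ≤ k, (pos p j).1 ≤ (pos p k).1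

/-- After `k` steps the walk is on the top side of its current box. -/
def OnTop (p : List Step) (k : ℕ) : Prop := ∀ j ≤ k, (pos p j).2 ≤ (pos p k).2

/-- After `k` steps the walk is on the bottom side of its current box. -/
def OnBottom (p : List Step) (k : ℕ) : Prop := ∀ j ≤ k, (pos p k).2 ≤ (pos p j).2

/-- The step from `pos p i` to `pos p (i + 1)` inflates the box: its end point lies outside the
bounding rectangle of `pos p 0, …, pos p i`. -/
def Inflates (p : List Step) (i : ℕ) : Prop :=
  (∀ j ≤ i, (pos p (i + 1)).1 < (pos p j).1) ∨ (∀ j ≤ i, (pos p j).1 < (pos p (i + 1)).1) ∨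
  (∀ j ≤ i, (pos p (i + 1)).2 < (pos p j).2) ∨ (∀ j ≤ i, (pos p j).2 < (pos p (i + 1)).2)

/-- Three-sided prudent walks: every step ends on the left, top or right side of the current box,
and every left or right step that ends on the bottom side of the current box inflates the box. -/
def IsThreeSided (p : List Step) : Prop :=
  IsPrudent p ∧ ∀ (i : ℕ) (hi : i < p.length),
    (OnLeft p (i + 1) ∨ OnTop p (i + 1) ∨ OnRight p (i + 1)) ∧
    ((p[i] = .left ∨ p[i] = .right) → OnBottom p (i + 1) → Inflates p i)

/-- Generic three-sided prudent polygons ending on the right: three-sided prudent walks from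
`(0, 0)` to `(1, 0)` which reach their terminal vertex from above, i.e. via `(1, 1)`.
(Such a walk is never a single edge.) -/
def IsGenericPolygon (p : List Step) : Prop :=
  IsThreeSided p ∧ pos p p.length = (1, 0) ∧ pos p (p.length - 1) = (1, 1)

/-- The smallest abscissa of a vertex of the walk (left side of the box). -/
def xMin (p : List Step) : ℤ :=
  (Finset.range (p.length + 1)).inf' Finset.nonempty_range_add_one fun i => (pos p i).1

/-- The largest abscissa of a vertex of the walk (right side of the box). -/
def xMax (p : List Step) : ℤ :=
  (Finset.range (p.length + 1)).sup' Finset.nonempty_range_add_one fun i => (pos p i).1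

/-- The largest ordinate of a vertex of the walk (top side of the box). -/
def yMax (p : List Step) : ℤ :=
  (Finset.range (p.length + 1)).sup' Finset.nonempty_range_add_one fun i => (pos p i).2

/-- Polygons of half-perimeter `n`: the walk together with the closing edge has `2 * n` edges. -/
def HasHalfPerimeter (p : List Step) (n : ℕ) : Prop := p.length + 1 = 2 * n

/-- The length of the top row: the number of unit edges of the walk on the top side of the box.
(These are the upper edges of the cells in the top row of the polygon.) -/
def topRowLength (p : List Step) : ℕ :=
  ((Finset.range p.length).filter
    fun i => (pos p i).2 = yMax p ∧ (pos p (i + 1)).2 = yMax p).card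

/-- The top left corner of the top row is at distance `j` from the top left corner of the box. -/
def HasTopGap (p : List Step) (j : ℕ) : Prop :=
  IsLeast {x : ℤ | ∃ i ≤ p.length, pos p i = (x, yMax p)} (xMin p + j)

/-- Generic polygons of half-perimeter `n` whose top row has length `i` and starts at distance `j`
from the left side of the box. -/
def genericPolygons (n i j : ℕ) : Set (List Step) :=
  {p | IsGenericPolygon p ∧ HasHalfPerimeter p n ∧ topRowLength p = i ∧ HasTopGap p j}

/-- Generic polygons of half-perimeter `n` and width `m`. -/
def genericPolygonsOfWidth (n m : ℕ) : Set (List Step) :=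
  {p | IsGenericPolygon p ∧ HasHalfPerimeter p n ∧ xMax p - xMin p = m}

theorem finite_halfPerimeter (n : ℕ) : {p | HasHalfPerimeter p n}.Finite :=
  (List.finite_length_lt Step (2 * n)).subset fun p hp => by
    simp only [HasHalfPerimeter, Set.mem_ofPred_eq] at hp ⊢
    omega

theorem genericPolygons_finite (n i j : ℕ) : (genericPolygons n i j).Finite :=
  (finite_halfPerimeter n).subset fun _ hp => hp.2.1

theorem genericPolygonsOfWidth_finite (n m : ℕ) : (genericPolygonsOfWidth n m).Finite :=
  (finite_halfPerimeter n).subset fun _ hp => hp.2.1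

/-! ### Bar graphs -/

/-- Total length of the vertical boundary edges to the right of a column of height `a` when the
columns of heights `l` follow. -/
def verticalEdges (a : ℕ) : List ℕ → ℕ
  | [] => a
  | h :: l => Nat.dist a h + verticalEdges h l

/-- Bar graphs of half-perimeter `n` and width `k`, given by their column heights: `k ≥ 1` columns
of positive height, with perimeter (horizontal plus vertical boundary edges) `2 * n`. -/
def barGraphs (n k : ℕ) : Set (List ℕ) :=
  {l | l ≠ [] ∧ (∀ h ∈ l, 1 ≤ h) ∧ l.length = k ∧ 2 * l.length + verticalEdges 0 l = 2 * n}

theorem le_verticalEdges (a : ℕ) (l : List ℕ) : a ≤ verticalEdges a l := by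
  induction l generalizing a with
  | nil => simp [verticalEdges]
  | cons x l ih =>
    have := ih x
    simp only [verticalEdges, Nat.dist]
    omega

theorem mem_le_verticalEdges (a : ℕ) (l : List ℕ) : ∀ h ∈ l, h ≤ verticalEdges a l := by
  induction l generalizing a with
  | nil => simp
  | cons x l ih =>
    intro h hh
    simp only [verticalEdges]
    rcases List.mem_cons.1 hh with rfl | hh
    · exact (le_verticalEdges _ _).trans (Nat.le_add_left _ _)
    · exact (ih x h hh).trans (Nat.le_add_left _ _)

theorem barGraphs_finite (n k : ℕ) : (barGraphs n k).Finite := by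
  refine ((List.finite_length_eq (Fin (2 * n + 1)) k).image (List.map Fin.val)).subset ?_
  rintro l ⟨-, -, hk, hn⟩
  have hb : ∀ h ∈ l, h < 2 * n + 1 := fun h hh => by
    have := mem_le_verticalEdges 0 l h hh
    omega
  exact ⟨l.pmap (fun h hh => ⟨h, hh⟩) hb, by simpa using hk, by simp [List.map_pmap]⟩

/-! ### Formal power series -/

noncomputable section

/-- The ring `ℚ⟦t, u, w⟧`, with the variables numbered `0, 1, 2`. -/
abbrev Series := MvPowerSeries (Fin 3) ℚ

/-- The variable `t`. -/
abbrev T : Series := MvPowerSeries.X 0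

/-- The variable `u`. -/
abbrev U : Series := MvPowerSeries.X 1

/-- The variable `w`. -/
abbrev W : Series := MvPowerSeries.X 2

/-- `F(t, a, b)` for a series `F = F(t, u, w)`. Meaningful when `a` and `b` have constant
term zero. -/
def evalUW (F a b : Series) : Series := MvPowerSeries.subst ![T, a, b] F

/-- The generating function `B(t, u)` of bar graphs by half-perimeter and width. -/
def B : Series := fun d => if d 2 = 0 then ((barGraphs (d 0) (d 1)).ncard : ℚ) else 0

/-- The generating function `R(t, u, w)` of generic three-sided prudent polygons by
half-perimeter, length of the top row and distance of the top row from the left side of the box. -/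
def R : Series := fun d => ((genericPolygons (d 0) (d 1) (d 2)).ncard : ℚ)

/-- The generating function of generic three-sided prudent polygons by half-perimeter
(variable `t`) and width (variable `w`). -/
def widthGF : Series :=
  fun d => if d 1 = 0 then ((genericPolygonsOfWidth (d 0) (d 2)).ncard : ℚ) else 0

/-- The functional equation
`F(t,u,w) = ut(B(t,u)+t) + ut (F(t,w,w)-F(t,u,w))/(w-u) + ut² (F(t,u,w)-F(t,u,ut))/(w-ut)
+ F(t,u,ut) ut (B(t,u)+t)`.
The two quotients are the (unique) power series `P` and `Q`. -/
def FunctionalEquation (F : Series) : Prop :=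
  ∃ P Q : Series,
    (W - U) * P = evalUW F W W - F ∧
    (W - U * T) * Q = F - evalUW F U (U * T) ∧
    F = U * T * (B + T) + U * T * P + U * T ^ 2 * Q + evalUW F U (U * T) * (U * T) * (B + T)

/-- `s` is the square root of `f` with constant term `1`. -/
def IsSqrt (s f : Series) : Prop := s ^ 2 = f ∧ MvPowerSeries.constantCoeff s = 1

/-- `q = (t² + 1 - √(1 - 4t + 2t² + t⁴)) / (2t)`. -/
def IsQ (q : Series) : Prop :=
  ∃ s : Series, IsSqrt s (1 - 4 * T + 2 * T ^ 2 + T ^ 4) ∧ 2 * T * q = T ^ 2 + 1 - s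

/-- `B(t, q x)`. -/
def Bq (q x : Series) : Series := evalUW B (q * x) W

/-- The common denominator of `K(x)` and `L(x)`; its constant term is `1`. -/
def denom (q x : Series) : Series :=
  1 - T * (1 + T) * q - (T * (1 - T - T ^ 3) * q + T ^ 2) * (Bq q x + T) * x

/-- `K(x)`. -/
def K (q x : Series) : Series :=
  ((1 - T) * q - 1 - ((1 - T + T ^ 2) * q - 1) * (Bq q x + T) * x) * (denom q x)⁻¹

/-- `L(x)`. -/
def L (q x : Series) : Series :=
  ((1 + T ^ 2 - (1 - 2 * T + 2 * T ^ 2 + T ^ 4) * q) * (Bq q x + T) * x) * (denom q x)⁻¹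

/-- `F = ∑_{k ≥ 0} f k` as formal power series in `t`: modulo every power of `t`, the partial sums
are eventually equal to `F`. -/
def IsFormalSum (f : ℕ → Series) (F : Series) : Prop :=
  ∀ N : ℕ, ∃ M : ℕ, ∀ m ≥ M, T ^ N ∣ F - ∑ k ∈ Finset.range m, f k

end

end PrudentPolygons

open PrudentPolygons

namespace PrudentPolygons

noncomputable section

/-! ### Substitution -/

/-! Prudence forces a generic polygon into a rigid shape. Its last vertex lies on the right side of
the box, so the walk stays in x ≤ 1; it crosses from x = 0 to x = 1 once, on the current top level,
and then descends straight to (1, 0) (`IsGenericPolygon.exists_code`). What precedes is a walk in x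
≤ 0, and such walks are read by a deterministic automaton, `WalkState.next`. The invariants
`TopInv`, `BackInv`, `SideInv` describe the visited set well enough to show that its transitions are
exactly the legal steps that stay in the half-plane (`next_spec`, `exists_next`). The walk up to its
last new top level is recorded by a `Code`, which says how each top level was reached: by an
excursion along the left side of the box, or by a horizontal move inside the box. An excursion is a
sequence of depths, that is, a bar graph or the empty sequence, whence the factor B + t.

Valid codes thus biject with polygons, and removing the last constructor of a code gives the four
terms of the functional equation; summing over the length of a horizontal move is a geometric sum,
which is a divided difference (`functionalEquation_R`). The right-hand side carries a factor t, and
division by w - u or w - ut loses no power of t, so the solution is unique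
(`FunctionalEquation.unique`).

The closed form comes from the kernel method. After clearing denominators, F(t,u,w) has the factor
w² - uw(1+t²) + u²t. For u = qx, with tq² - (1+t²)q + 1 = 0, this vanishes at w = x and at w = tq²x.
Both equations contain R(t,u,ut); eliminating it gives H(x) = L(x) + K(x)H(tq²x) for H(x) = R(t,x,x)
(`recurrence`). Since q ≡ 1 mod t, the series K is divisible by t, so iteration from x = w converges
(`isFormalSum_R`). The root formula for B comes from a quadratic equation, obtained by cutting a
height sequence at its first zero (`B_quadratic`). -/

theorem hasSubst_evalUW {a b : Series} (ha : MvPowerSeries.constantCoeff a = 0)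
    (hb : MvPowerSeries.constantCoeff b = 0) : MvPowerSeries.HasSubst ![T, a, b] :=
  MvPowerSeries.hasSubst_of_constantCoeff_zero fun i => by
    fin_cases i <;> simp [ha, hb]

/-- The substitution `F ↦ F(t, a, b)` as a ring homomorphism. -/
def evalHom {a b : Series} (ha : MvPowerSeries.constantCoeff a = 0)
    (hb : MvPowerSeries.constantCoeff b = 0) : Series →ₐ[ℚ] Series :=
  MvPowerSeries.substAlgHom (hasSubst_evalUW ha hb)

theorem evalHom_apply {a b : Series} (ha : MvPowerSeries.constantCoeff a = 0)
    (hb : MvPowerSeries.constantCoeff b = 0) (F : Series) : evalHom ha hb F = evalUW F a b := by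
  rw [evalHom, MvPowerSeries.substAlgHom_apply]; rfl

theorem evalUW_T {a b : Series} (ha : MvPowerSeries.constantCoeff a = 0)
    (hb : MvPowerSeries.constantCoeff b = 0) : evalUW T a b = T := by
  rw [evalUW, MvPowerSeries.subst_X (hasSubst_evalUW ha hb)]; rfl

theorem evalUW_U {a b : Series} (ha : MvPowerSeries.constantCoeff a = 0)
    (hb : MvPowerSeries.constantCoeff b = 0) : evalUW U a b = a := by
  rw [evalUW, MvPowerSeries.subst_X (hasSubst_evalUW ha hb)]; rfl

theorem evalUW_W {a b : Series} (ha : MvPowerSeries.constantCoeff a = 0)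
    (hb : MvPowerSeries.constantCoeff b = 0) : evalUW W a b = b := by
  rw [evalUW, MvPowerSeries.subst_X (hasSubst_evalUW ha hb)]; rfl

theorem evalUW_evalUW {a b c d : Series} (ha : MvPowerSeries.constantCoeff a = 0)
    (hb : MvPowerSeries.constantCoeff b = 0) (hc : MvPowerSeries.constantCoeff c = 0)
    (hd : MvPowerSeries.constantCoeff d = 0) (F : Series) :
    evalUW (evalUW F a b) c d = evalUW F (evalUW a c d) (evalUW b c d) := by
  rw [evalUW, evalUW, MvPowerSeries.subst_comp_subst_apply (hasSubst_evalUW ha hb)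
    (hasSubst_evalUW hc hd), evalUW]
  congr 1
  funext i
  fin_cases i
  · exact evalUW_T hc hd
  · rfl
  · rfl

/-! ### Formal sums -/

open scoped MvPowerSeries.WithPiTopology

/-- The discrete uniformity on the coefficients. -/
@[reducible] def discreteUniformSpace : UniformSpace ℚ := ⊥

attribute [local instance] discreteUniformSpace

/-- The discrete topology on the coefficients. -/
@[reducible] def discreteTopologicalSpace : TopologicalSpace ℚ :=
  discreteUniformSpace.toTopologicalSpace

attribute [local instance] discreteTopologicalSpace

theorem discreteUniformity : DiscreteUniformity ℚ := ⟨rfl⟩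

attribute [local instance] discreteUniformity

/-- Discrete coefficients make substitution continuous, so a generating function written as an
infinite sum of monomials can be evaluated term by term. -/
theorem continuous_evalHom {a b : Series} (ha : MvPowerSeries.constantCoeff a = 0)
    (hb : MvPowerSeries.constantCoeff b = 0) : Continuous (evalHom ha hb) := by
  have : ⇑(evalHom ha hb) = MvPowerSeries.subst ![T, a, b] :=
    MvPowerSeries.coe_substAlgHom (hasSubst_evalUW ha hb)
  rw [this]
  exact MvPowerSeries.continuous_subst (hasSubst_evalUW ha hb)

theorem monomial_pow_eq (i j k : ℕ) : (T ^ i * U ^ j * W ^ k : Series) =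
    MvPowerSeries.monomial (Finsupp.single 0 i + Finsupp.single 1 j + Finsupp.single 2 k) 1 := by
  simp [MvPowerSeries.X_pow_eq, MvPowerSeries.monomial_mul_monomial]

theorem coeff_monomial_pow (i j k : ℕ) (d : Fin 3 →₀ ℕ) :
    MvPowerSeries.coeff d (T ^ i * U ^ j * W ^ k : Series) =
      if i = d 0 ∧ j = d 1 ∧ k = d 2 then 1 else 0 := by
  rw [monomial_pow_eq, MvPowerSeries.coeff_monomial]
  congr 1
  simp [Finsupp.ext_iff, Fin.forall_fin_succ, eq_comm]

/-- Only finitely many elements have a bounded value of the statistic `i`. -/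
def FiniteLevels {α : Type*} (i : α → ℕ) : Prop := ∀ n, {a | i a ≤ n}.Finite

/-- The generating function of the elements of `α` by the statistics `i`, `j`, `k`. -/
theorem hasSum_gf {α : Type*} {i j k : α → ℕ} (hfin : FiniteLevels i) {F : Series}
    (hF : ∀ d, MvPowerSeries.coeff d F =
      ({a | i a = d 0 ∧ j a = d 1 ∧ k a = d 2}.ncard : ℚ)) :
    HasSum (fun a => (T ^ i a * U ^ j a * W ^ k a : Series)) F := by
  rw [MvPowerSeries.WithPiTopology.hasSum_iff_hasSum_coeff]
  intro d
  have hf : {a | i a = d 0 ∧ j a = d 1 ∧ k a = d 2}.Finite :=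
    (hfin (d 0)).subset fun a ha => ha.1.le
  have hsum : ∑ a ∈ hf.toFinset, MvPowerSeries.coeff d (T ^ i a * U ^ j a * W ^ k a : Series) =
      MvPowerSeries.coeff d F := by
    rw [Finset.sum_congr rfl (g := fun _ => (1 : ℚ)) (fun a ha => by
      rw [coeff_monomial_pow, if_pos (by simpa using ha)])]
    rw [Finset.sum_const, nsmul_one, ← Set.ncard_eq_toFinset_card _ hf, hF]
  rw [← hsum]
  exact hasSum_sum_of_ne_finset_zero (L := SummationFilter.unconditional α) fun a ha => by
    rw [coeff_monomial_pow, if_neg (by simpa using ha)]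

theorem summable_gf {α : Type*} {i : α → ℕ} (j k : α → ℕ) (hfin : FiniteLevels i) :
    Summable (fun a => (T ^ i a * U ^ j a * W ^ k a : Series)) :=
  ⟨_, hasSum_gf hfin (F := fun d => ({a | i a = d 0 ∧ j a = d 1 ∧ k a = d 2}.ncard : ℚ))
    fun _ => rfl⟩

theorem hasSum_evalUW {α : Type*} {a b : Series} (ha : MvPowerSeries.constantCoeff a = 0)
    (hb : MvPowerSeries.constantCoeff b = 0) {i j k : α → ℕ} {F : Series}
    (h : HasSum (fun x => (T ^ i x * U ^ j x * W ^ k x : Series)) F) :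
    HasSum (fun x => (T ^ i x * a ^ j x * b ^ k x : Series)) (evalUW F a b) := by
  have := h.map (evalHom ha hb) (continuous_evalHom ha hb)
  rw [evalHom_apply] at this
  convert this using 2 with x
  simp only [Function.comp, map_mul, map_pow, evalHom_apply, evalUW_T ha hb, evalUW_U ha hb,
    evalUW_W ha hb]

theorem FiniteLevels.mono {α : Type*} {i j : α → ℕ} (hi : FiniteLevels i) (h : ∀ a, i a ≤ j a) :
    FiniteLevels j := fun n => (hi n).subset fun a ha => (h a).trans ha

theorem FiniteLevels.sigma_fin {α : Type*} {i : α → ℕ} (hi : FiniteLevels i) (m : α → ℕ) :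
    FiniteLevels (fun x : (a : α) × Fin (m a) => i x.1) := by
  intro n
  have := (hi n).to_subtype
  refine (Set.finite_range (fun x : (a : {a | i a ≤ n}) × Fin (m a) =>
    (⟨x.1, x.2⟩ : (a : α) × Fin (m a)))).subset ?_
  rintro ⟨a, r⟩ h
  exact ⟨⟨⟨a, h⟩, r⟩, rfl⟩

theorem FiniteLevels.prod {α β : Type*} {i : α → ℕ} {j : β → ℕ} (hi : FiniteLevels i)
    (hj : FiniteLevels j) : FiniteLevels (fun x : α × β => i x.1 + j x.2) := by
  intro n
  refine ((hi n).prod (hj n)).subset ?_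
  rintro ⟨a, b⟩ h
  simp only [Set.mem_ofPred_eq, Set.mem_prod] at h ⊢
  omega

theorem hasSum_of_eq {α : Type*} {f g : α → Series} {F : Series} (hf : HasSum f F)
    (h : ∀ a, g a = f a) : HasSum g F := by
  rwa [funext h]

theorem hasSum_prod {α β : Type*} {f : α → Series} {g : β → Series} {F G : Series}
    (hf : HasSum f F) (hg : HasSum g G) (h : Summable fun x : α × β => f x.1 * g x.2) :
    HasSum (fun x : α × β => f x.1 * g x.2) (F * G) := HasSum.mul hf hg h

theorem hasSum_sum_type {α β : Type*} {f : α ⊕ β → Series} {F G : Series}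
    (hf : HasSum (fun a => f (.inl a)) F) (hg : HasSum (fun b => f (.inr b)) G) :
    HasSum f (F + G) := HasSum.sum hf hg

theorem hasSum_sigma_fin {α : Type*} {m : α → ℕ} {f : (a : α) × Fin (m a) → Series} {F : Series}
    (hf : HasSum f F) : HasSum (fun a => ∑ r : Fin (m a), f ⟨a, r⟩) F :=
  hf.sigma fun _ => hasSum_fintype _

/-! ### Bar graphs -/

/-- Total rise of a sequence of heights, starting from height `a`. -/
def rise (a : ℕ) : List ℕ → ℕ
  | [] => 0
  | h :: l => (h - a) + rise h l

/-- The profile starts at height `a` and ends at height 0, so its total fall exceeds its total rise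
by `a`. -/
theorem verticalEdges_eq (a : ℕ) (l : List ℕ) : verticalEdges a l = 2 * rise a l + a := by
  induction l generalizing a with
  | nil => simp [verticalEdges, rise]
  | cons h l ih => simp only [verticalEdges, rise, ih, Nat.dist]; omega

theorem rise_map_succ (a : ℕ) (l : List ℕ) : rise (a + 1) (l.map (· + 1)) = rise a l := by
  induction l generalizing a with
  | nil => rfl
  | cons h l ih => simp only [List.map_cons, rise, ih]; omega

theorem rise_zero_map_succ {l : List ℕ} (hl : l ≠ []) :
    rise 0 (l.map (· + 1)) = rise 0 l + 1 := by
  cases l with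
  | nil => contradiction
  | cons h l => simp only [List.map_cons, rise, rise_map_succ]; omega

theorem rise_append_zero_cons (a : ℕ) (l r : List ℕ) :
    rise a (l ++ 0 :: r) = rise a l + rise 0 r := by
  induction l generalizing a with
  | nil => simp [rise]
  | cons h l ih => simp only [List.cons_append, rise, ih]; omega

/-- Half-perimeter (up to one unit) of the bar graph whose columns have heights `h + 1`, `h ∈ l`. -/
def barSize (l : List ℕ) : ℕ := l.length + rise 0 l

theorem finiteLevels_barSize : FiniteLevels barSize := by
  intro n
  have hf : (⋃ k ∈ Set.Iic n, {l : List (Fin (2 * n + 1)) | l.length = k}).Finite :=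
    (Set.finite_Iic n).biUnion fun k _ => List.finite_length_eq _ k
  refine (hf.image (List.map Fin.val)).subset fun l hl => ?_
  simp only [Set.mem_ofPred_eq, barSize] at hl
  have hb : ∀ h ∈ l, h < 2 * n + 1 := fun h hh => by
    have := mem_le_verticalEdges 0 l h hh
    rw [verticalEdges_eq] at this
    omega
  refine ⟨l.pmap (fun h hh => ⟨h, hh⟩) hb, ?_, by simp [List.map_pmap]⟩
  simp only [Set.mem_iUnion]
  exact ⟨l.length, by simp only [Set.mem_Iic]; omega, by simp⟩

theorem mem_barGraphs_iff (n k : ℕ) (l : List ℕ) :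
    l ∈ barGraphs n k ↔ ∃ l', l' ≠ [] ∧ l = l'.map (· + 1) ∧ l'.length = k ∧ barSize l' + 1 = n := by
  constructor
  · rintro ⟨h0, h1, h2, h3⟩
    have hl : (l.map (· - 1)).map (· + 1) = l := by
      rw [List.map_map]
      conv_rhs => rw [← List.map_id l]
      exact List.map_congr_left fun h hh => by have := h1 h hh; simp only [Function.comp, id]; omega
    have hne : l.map (· - 1) ≠ [] := by simpa using h0
    refine ⟨l.map (· - 1), hne, hl.symm, by simpa using h2, ?_⟩
    rw [← hl, verticalEdges_eq, rise_zero_map_succ hne] at h3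
    simp only [barSize, List.length_map] at h3 ⊢
    omega
  · rintro ⟨l', h0, rfl, h2, h3⟩
    refine ⟨by simpa using h0, by simp, by simpa using h2, ?_⟩
    rw [verticalEdges_eq, rise_zero_map_succ h0]
    simp only [barSize, List.length_map] at h3 ⊢
    omega

/-- Lowering every column by one turns bar graphs into non-empty lists of arbitrary heights. The
empty list supplies the extra term `T`, so this sum runs over all lists, as needed for the
excursions of a walk. -/
theorem hasSum_B_add_T :
    HasSum (fun l : List ℕ => (T ^ (barSize l + 1) * U ^ l.length * W ^ 0 : Series)) (B + T) := by
  refine hasSum_gf (finiteLevels_barSize.mono fun l => Nat.le_succ _) fun d => ?_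
  have hB : MvPowerSeries.coeff d B =
      if d 2 = 0 then ((barGraphs (d 0) (d 1)).ncard : ℚ) else 0 := rfl
  have hT : MvPowerSeries.coeff d T = if 1 = d 0 ∧ 0 = d 1 ∧ 0 = d 2 then (1 : ℚ) else 0 := by
    simpa using coeff_monomial_pow 1 0 0 d
  rw [map_add, hB, hT]
  by_cases h2 : d 2 = 0
  · have hinj : Function.Injective (List.map (· + 1) : List ℕ → List ℕ) :=
      List.map_injective_iff.2 fun a b h => by simpa using h
    by_cases h1 : d 1 = 0
    · have hempty : barGraphs (d 0) (d 1) = ∅ := by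
        ext l
        simp only [mem_barGraphs_iff, Set.mem_empty_iff_false, iff_false]
        rintro ⟨l', h, -, hl, -⟩
        rw [h1] at hl
        exact h (List.length_eq_zero_iff.1 hl)
      rw [hempty, Set.ncard_empty]
      by_cases h0 : d 0 = 1
      · have : {a : List ℕ | barSize a + 1 = d 0 ∧ a.length = d 1 ∧ 0 = d 2} = {[]} := by
          ext l
          simp only [Set.mem_ofPred_eq, Set.mem_singleton_iff, h0, h1, h2,
            List.length_eq_zero_iff]
          constructor
          · exact fun h => h.2.1
          · rintro rfl; simp [barSize, rise]
        rw [this]; simp [h0, h1, h2]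
      · have : {a : List ℕ | barSize a + 1 = d 0 ∧ a.length = d 1 ∧ 0 = d 2} = ∅ := by
          ext l
          simp only [Set.mem_ofPred_eq, Set.mem_empty_iff_false, iff_false, h1,
            List.length_eq_zero_iff]
          rintro ⟨h, rfl, -⟩
          simp [barSize, rise] at h
          omega
        rw [this]; simp [Ne.symm h0]
    · have : barGraphs (d 0) (d 1) = (List.map (· + 1)) ''
          {a : List ℕ | barSize a + 1 = d 0 ∧ a.length = d 1 ∧ 0 = d 2} := by
        ext l
        simp only [mem_barGraphs_iff, Set.mem_image, Set.mem_ofPred_eq, h2]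
        constructor
        · rintro ⟨l', -, h, h', h''⟩; exact ⟨l', ⟨h'', h', trivial⟩, h.symm⟩
        · rintro ⟨l', ⟨h'', h', -⟩, h⟩
          refine ⟨l', ?_, h.symm, h', h''⟩
          rintro rfl
          exact h1 h'.symm
      rw [this, Set.ncard_image_of_injective _ hinj]
      simp [h2, Ne.symm h1]
  · have : {a : List ℕ | barSize a + 1 = d 0 ∧ a.length = d 1 ∧ 0 = d 2} = ∅ := by
      ext l
      simp [Ne.symm h2]
    rw [this]; simp [h2, Ne.symm h2]

/-- Raising a non-empty list by one adds one to its rise, so only the empty list changes weight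
compared with `hasSum_B_add_T`: from `T` to 1. -/
theorem hasSum_one_add_B :
    HasSum (fun l : List ℕ =>
      (T ^ (l.length + rise 0 (l.map (· + 1))) * U ^ l.length * W ^ 0 : Series)) (1 + B) := by
  have h := hasSum_B_add_T.add (hasSum_ite_eq ([] : List ℕ) (1 - T : Series))
  have e : B + T + (1 - T) = 1 + B := by ring
  rw [e] at h
  convert h using 2 with l
  by_cases hl : l = []
  · subst hl; simp [barSize, rise]
  · rw [if_neg hl, rise_zero_map_succ hl, barSize, add_assoc, add_zero]

/-! ### The quadratic equation of the bar graph series -/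

/-- Splitting a list of heights at its first zero. -/
def splitZero : List ℕ → List ℕ ⊕ List ℕ × List ℕ
  | [] => .inl []
  | 0 :: l => .inr ([], l)
  | (h + 1) :: l => (splitZero l).map (List.cons h) (Prod.map (List.cons h) id)

/-- The inverse of `splitZero`. -/
def joinZero : List ℕ ⊕ List ℕ × List ℕ → List ℕ :=
  Sum.elim (List.map (· + 1)) fun x => x.1.map (· + 1) ++ 0 :: x.2

theorem joinZero_splitZero (l : List ℕ) : joinZero (splitZero l) = l := by
  induction l with
  | nil => rfl
  | cons h l ih =>
    cases h with
    | zero => rfl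
    | succ h =>
      rw [splitZero]
      rcases hs : splitZero l with a | ⟨a, b⟩ <;> rw [hs] at ih <;> rw [← ih] <;> simp [joinZero]

theorem splitZero_joinZero (x : List ℕ ⊕ List ℕ × List ℕ) : splitZero (joinZero x) = x := by
  rcases x with a | ⟨a, b⟩
  · induction a with
    | nil => rfl
    | cons h a ih =>
      simp only [joinZero, Sum.elim_inl, List.map_cons, splitZero] at ih ⊢
      rw [ih]; rfl
  · induction a with
    | nil => rfl
    | cons h a ih =>
      simp only [joinZero, Sum.elim_inr, List.map_cons, List.cons_append, splitZero] at ih ⊢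
      rw [ih]; rfl

/-- Splitting a list of heights at its first zero, as an equivalence. -/
def splitZeroEquiv : List ℕ ⊕ List ℕ × List ℕ ≃ List ℕ :=
  ⟨joinZero, splitZero, splitZero_joinZero, joinZero_splitZero⟩

theorem finiteLevels_raised :
    FiniteLevels fun l : List ℕ => l.length + rise 0 (l.map (· + 1)) := by
  refine finiteLevels_barSize.mono fun l => ?_
  by_cases hl : l = []
  · simp [hl, barSize, rise]
  · rw [rise_zero_map_succ hl, barSize]; omega

/-- A list of heights either has no zero, and is then a raised list, or is a raised list followed by
a zero and an arbitrary list. Rises add up at a zero, so the weights multiply. -/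
theorem B_quadratic : B + T = T * (1 + B) + T * U * ((1 + B) * (B + T)) := by
  have hfin := finiteLevels_raised.prod
    (finiteLevels_barSize.mono (j := fun l => barSize l + 1) fun l => Nat.le_succ _)
  have hprod := hasSum_prod hasSum_one_add_B hasSum_B_add_T
    ((summable_gf (fun x => x.1.length + x.2.length) (fun _ => 0) hfin).congr fun x => by ring)
  have h : HasSum
      (fun x => (T ^ (barSize (joinZero x) + 1) * U ^ (joinZero x).length * W ^ 0 : Series))
      (T * (1 + B) + T * U * ((1 + B) * (B + T))) := by
    refine hasSum_sum_type ?_ ?_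
    · refine hasSum_of_eq (hasSum_one_add_B.mul_left T) fun l => ?_
      simp only [joinZero, Sum.elim_inl, barSize, List.length_map]
      ring
    · refine hasSum_of_eq (hprod.mul_left (T * U)) fun x => ?_
      simp only [joinZero, Sum.elim_inr, barSize, List.length_append, List.length_map,
        List.length_cons, rise_append_zero_cons]
      ring
  exact (splitZeroEquiv.hasSum_iff.2 hasSum_B_add_T).unique h

/-- The explicit form of the bar graph series. -/
theorem exists_isSqrt_B : ∃ s : Series,
    IsSqrt s (T ^ 2 * (1 - T) ^ 2 * U ^ 2 - 2 * T * (1 - T ^ 2) * U + (1 - T) ^ 2) ∧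
      2 * T * U * B = 1 - T - U * (1 + T) * T - s := by
  -- The root is defined by solving the desired formula for it; that its square is the discriminant
  -- is the quadratic equation with the square completed.
  refine ⟨1 - T - U * (1 + T) * T - 2 * T * U * B, ⟨?_, by simp⟩, by ring⟩
  linear_combination (-4 * T * U) * B_quadratic

end

/-! ### Extending walks by one step -/

theorem pos_append_of_le {p : List Step} (q : List Step) {i : ℕ} (hi : i ≤ p.length) :
    pos (p ++ q) i = pos p i := by
  simp [pos, List.take_append_of_le_length hi]

theorem pos_append_add (p q : List Step) (i : ℕ) :
    pos (p ++ q) (p.length + i) = pos p p.length + pos q i := by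
  simp [pos, List.take_append, List.take_of_length_le]

theorem pos_succ {p : List Step} {i : ℕ} (hi : i < p.length) :
    pos p (i + 1) = pos p i + (p[i]).vec := by
  rw [pos, pos, List.take_succ_eq_append_getElem hi, List.map_append, List.sum_append]
  simp

/-- The set of vertices of a walk. -/
def visited (p : List Step) : Set (ℤ × ℤ) := {v | ∃ j ≤ p.length, pos p j = v}

theorem visited_nil : visited [] = {(0, 0)} := by
  ext v
  simp [visited, pos, eq_comm, Prod.ext_iff]

theorem visited_append_singleton (p : List Step) (s : Step) :
    visited (p ++ [s]) = insert (pos p p.length + s.vec) (visited p) := by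
  have hlast : pos (p ++ [s]) (p.length + 1) = pos p p.length + s.vec := by
    rw [pos_append_add]; simp [pos]
  ext v
  simp only [visited, List.length_append, List.length_singleton, Set.mem_insert_iff,
    Set.mem_ofPred_eq]
  constructor
  · rintro ⟨j, hj, rfl⟩
    rcases Nat.lt_or_ge p.length j with h | h
    · left
      obtain rfl : j = p.length + 1 := by omega
      exact hlast
    · right
      exact ⟨j, h, (pos_append_of_le _ h).symm⟩
  · rintro (rfl | ⟨j, hj, rfl⟩)
    · exact ⟨_, le_rfl, hlast⟩
    · exact ⟨j, by omega, pos_append_of_le _ hj⟩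

/-- No vertex of `V` lies on the open ray from `e` in the direction of the step. -/
def Clear (V : Set (ℤ × ℤ)) (e : ℤ × ℤ) : Step → Prop
  | .left => ∀ v ∈ V, v.2 = e.2 → e.1 ≤ v.1
  | .right => ∀ v ∈ V, v.2 = e.2 → v.1 ≤ e.1
  | .up => ∀ v ∈ V, v.1 = e.1 → v.2 ≤ e.2
  | .down => ∀ v ∈ V, v.1 = e.1 → e.2 ≤ v.2

theorem clear_iff (V : Set (ℤ × ℤ)) (e : ℤ × ℤ) (s : Step) :
    Clear V e s ↔ ∀ v ∈ V, ∀ m : ℕ, 1 ≤ m → v ≠ e + m • s.vec := by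
  obtain ⟨a, b⟩ := e
  cases s <;> simp only [Clear, Step.vec, Prod.smul_mk, Prod.mk_add_mk, nsmul_eq_mul] <;>
    refine forall₂_congr fun v _ => ?_ <;> obtain ⟨c, d⟩ := v <;>
    simp only [ne_eq, Prod.mk.injEq]
  · refine ⟨fun h m hm h' => by have := h (by omega); omega, fun h h' => ?_⟩
    by_contra hc
    exact h (a - c).toNat (by omega) ⟨by omega, by omega⟩
  · refine ⟨fun h m hm h' => by have := h (by omega); omega, fun h h' => ?_⟩
    by_contra hc
    exact h (c - a).toNat (by omega) ⟨by omega, by omega⟩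
  · refine ⟨fun h m hm h' => by have := h (by omega); omega, fun h h' => ?_⟩
    by_contra hc
    exact h (d - b).toNat (by omega) ⟨by omega, by omega⟩
  · refine ⟨fun h m hm h' => by have := h (by omega); omega, fun h h' => ?_⟩
    by_contra hc
    exact h (b - d).toNat (by omega) ⟨by omega, by omega⟩

/-- The vertex `e` lies on the left, top or right side of the bounding rectangle of `V`. -/
def OnSide (V : Set (ℤ × ℤ)) (e : ℤ × ℤ) : Prop :=
  (∀ v ∈ V, e.1 ≤ v.1) ∨ (∀ v ∈ V, v.2 ≤ e.2) ∨ (∀ v ∈ V, v.1 ≤ e.1)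

/-- The vertex `e` lies outside the bounding rectangle of `V`. -/
def Outside (V : Set (ℤ × ℤ)) (e : ℤ × ℤ) : Prop :=
  (∀ v ∈ V, e.1 < v.1) ∨ (∀ v ∈ V, v.1 < e.1) ∨ (∀ v ∈ V, e.2 < v.2) ∨ (∀ v ∈ V, v.2 < e.2)

/-- The step `s` may follow a three-sided walk that has visited `V` and ended in `e`. -/
def StepOK (V : Set (ℤ × ℤ)) (e : ℤ × ℤ) (s : Step) : Prop :=
  Clear V e s ∧ OnSide V (e + s.vec) ∧
    (s = .left ∨ s = .right → (∀ v ∈ V, (e + s.vec).2 ≤ v.2) → Outside V (e + s.vec))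

/-- The side conditions compare the new vertex with all vertices up to and including itself. The
comparison with itself is trivial, so legality of a step depends only on the visited set and the
current end point. -/
theorem isThreeSided_iff (p : List Step) :
    IsThreeSided p ↔ ∀ (i : ℕ) (hi : i < p.length), StepOK (visited (p.take i)) (pos p i) p[i] := by
  have hv : ∀ i < p.length, ∀ P : ℤ × ℤ → Prop,
      (∀ v ∈ visited (p.take i), P v) ↔ ∀ j ≤ i, P (pos p j) := by
    intro i hi P
    have hpos : ∀ j ≤ i, pos (p.take i) j = pos p j := fun j hj => by
      simp [pos, List.take_take, hj]
    simp only [visited, Set.mem_ofPred_eq, List.length_take, min_eq_left hi.le]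
    constructor
    · exact fun h j hj => h _ ⟨j, hj, hpos j hj⟩
    · rintro h v ⟨j, hj, rfl⟩
      rw [hpos j hj]; exact h j hj
  have hle : ∀ i, ∀ P : ℕ → Prop, P (i + 1) → ((∀ j ≤ i + 1, P j) ↔ ∀ j ≤ i, P j) := by
    intro i P h
    constructor
    · exact fun h' j hj => h' j (by omega)
    · intro h' j hj
      rcases Nat.lt_or_ge i j with h'' | h''
      · rwa [show j = i + 1 by omega]
      · exact h' j h''
  rw [IsThreeSided, IsPrudent, ← forall₂_and]
  refine forall₂_congr fun i hi => ?_
  rw [StepOK, clear_iff, OnSide, Outside, ← pos_succ hi, hv i hi, hv i hi, hv i hi, hv i hi,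
    hv i hi, hv i hi, hv i hi, hv i hi, hv i hi]
  rw [OnLeft, OnTop, OnRight, OnBottom,
    hle i (fun j => (pos p (i + 1)).1 ≤ (pos p j).1) le_rfl,
    hle i (fun j => (pos p j).2 ≤ (pos p (i + 1)).2) le_rfl,
    hle i (fun j => (pos p j).1 ≤ (pos p (i + 1)).1) le_rfl,
    hle i (fun j => (pos p (i + 1)).2 ≤ (pos p j).2) le_rfl]
  rfl

theorem isThreeSided_append_singleton (p : List Step) (s : Step) :
    IsThreeSided (p ++ [s]) ↔ IsThreeSided p ∧ StepOK (visited p) (pos p p.length) s := by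
  simp only [isThreeSided_iff]
  constructor
  · intro h
    refine ⟨fun i hi => ?_, ?_⟩
    · have := h i (by simp; omega)
      rwa [List.take_append_of_le_length hi.le, pos_append_of_le _ hi.le,
        List.getElem_append_left hi] at this
    · have := h p.length (by simp)
      rwa [List.take_left, pos_append_of_le _ le_rfl, List.getElem_concat_length rfl] at this
  · rintro ⟨h1, h2⟩ i hi
    rcases Nat.lt_or_ge i p.length with h | h
    · rw [List.take_append_of_le_length h.le, pos_append_of_le _ h.le,
        List.getElem_append_left h]
      exact h1 i h
    · obtain rfl : i = p.length := by simp at hi; omega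
      rwa [List.take_left, pos_append_of_le _ le_rfl, List.getElem_concat_length rfl]

theorem isThreeSided_nil : IsThreeSided [] := by
  rw [isThreeSided_iff]; simp

theorem IsThreeSided.of_append {p q : List Step} (h : IsThreeSided (p ++ q)) :
    IsThreeSided p := by
  induction q using List.reverseRecOn with
  | nil => simpa using h
  | append_singleton q s ih =>
    rw [← List.append_assoc, isThreeSided_append_singleton] at h
    exact ih h.1

/-- Prudent walks are self-avoiding. -/
theorem IsPrudent.pos_ne {p : List Step} (h : IsPrudent p) {i j : ℕ} (hij : i < j)
    (hj : j ≤ p.length) : pos p i ≠ pos p j := by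
  obtain ⟨j, rfl⟩ : ∃ k, j = k + 1 := ⟨j - 1, by omega⟩
  have := h j (by omega) i (by omega) 1 le_rfl
  rwa [one_smul, ← pos_succ] at this

/-! ### The geometry of walks to the left of the line `x = 0` -/

/-- Properties of the set `V` of vertices of a walk in the half-plane `x ≤ 0` whose box has top
side `y = h` and left side `x = m`. -/
structure Common (V : Set (ℤ × ℤ)) (h m : ℤ) : Prop where
  origin : (0, 0) ∈ V
  bounds : ∀ v ∈ V, m ≤ v.1 ∧ v.1 ≤ 0 ∧ v.2 ≤ h
  level : ∀ v ∈ V, ∀ b, v.2 ≤ b → b ≤ h → ∃ a, (a, b) ∈ V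

/-- The walk has moved right, from abscissa `x₀` to `x`, after reaching the top level `h`. -/
structure TopInv (V : Set (ℤ × ℤ)) (x₀ x h m : ℤ) : Prop extends Common V h m where
  one_le : 1 ≤ h
  m_le : m ≤ x₀
  x₀_le : x₀ ≤ x
  x_le : x ≤ 0
  row : ∀ a, (a, h) ∈ V ↔ x₀ ≤ a ∧ a ≤ x
  below : (x₀, h - 1) ∈ V
  corner : ∃ y < h, (m, y) ∈ V

/-- The walk has moved left inside its box, from abscissa `x₀` to `x`, after reaching the top
level `h`. -/
structure BackInv (V : Set (ℤ × ℤ)) (x₀ x h m : ℤ) : Prop extends Common V h m where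
  one_le : 1 ≤ h
  m_le : m ≤ x
  x_lt : x < x₀
  x₀_le : x₀ ≤ 0
  row : ∀ a, (a, h) ∈ V ↔ x ≤ a ∧ a ≤ x₀
  corner : ∃ y < h, (m, y) ∈ V

/-- The walk has moved vertically on the left side of its box, from ordinate `y₁` to `y`. -/
structure SideInv (V : Set (ℤ × ℤ)) (x y h y₁ : ℤ) : Prop extends Common V h x where
  x_le : x ≤ 0
  y_le : y ≤ h
  y₁_le : y₁ ≤ h
  col : ∀ b, (x, b) ∈ V ↔ y ≤ b ∧ b ≤ y₁ ∨ y₁ ≤ b ∧ b ≤ y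
  right : x < 0 → (∀ v ∈ V, y ≤ v.2) ∨ ∃ a > x, (a, y) ∈ V

section steps

variable {V : Set (ℤ × ℤ)} {x₀ x h m y y₁ : ℤ}

/-- The occupied levels stay without holes: `e` is at most one level below some visited vertex, and
a level above `h` can only be that of `e` itself. -/
theorem Common.insert (H : Common V h m) {m' h' : ℤ} {e : ℤ × ℤ} (hm : m' ≤ m)
    (hh : h' ≤ h + 1) (hhe : h ≤ h') (he : m' ≤ e.1 ∧ e.1 ≤ 0 ∧ e.2 ≤ h')
    (htop : h' = h + 1 → e.2 = h') (hadj : ∃ v ∈ V, v.2 ≤ e.2 + 1) :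
    Common (insert e V) h' m' where
  origin := Or.inr H.origin
  bounds := by
    rintro v (rfl | hv)
    · exact he
    · have := H.bounds v hv; omega
  level := by
    intro v hv b h1 h2
    by_cases hb : b = e.2
    · exact ⟨e.1, Or.inl (by rw [hb])⟩
    · have hb' : b ≤ h := by
        by_contra hc
        have : h' = h + 1 := by omega
        exact hb (by rw [htop this]; omega)
      obtain ⟨a, ha⟩ : ∃ a, (a, b) ∈ V := by
        rcases hv with rfl | hv
        · obtain ⟨w, hw, hw'⟩ := hadj
          exact H.level w hw b (by omega) hb'
        · exact H.level v hv b h1 hb'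
      exact ⟨a, Or.inr ha⟩

namespace TopInv

variable (H : TopInv V x₀ x h m)
include H

theorem mem : (x, h) ∈ V := (H.row x).2 ⟨H.x₀_le, le_rfl⟩

/-- The vertex in `corner` lies below the top level, so the top row is not the bottom row and the
inflation condition is void. -/
theorem left_ok (hx : x = x₀) : StepOK V (x, h) .left := by
  obtain ⟨y, hy, hc⟩ := H.corner
  refine ⟨?_, Or.inr (Or.inl fun v hv => by simpa [Step.vec] using (H.bounds v hv).2.2), ?_⟩
  · rintro ⟨a, b⟩ hv rfl
    have := (H.row a).1 hv
    simp only; omega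
  · intro _ hb
    have := hb _ hc
    simp [Step.vec] at this; omega

theorem left_not_ok (hx : x ≠ x₀) : ¬ StepOK V (x, h) .left := by
  intro hs
  have h0 := H.x₀_le
  have := hs.1 _ ((H.row x₀).2 ⟨le_rfl, h0⟩) rfl
  simp only at this; omega

theorem left_back (hx : x = x₀) (hm : m < x₀) :
    BackInv (insert (x - 1, h) V) x₀ (x - 1) h m where
  toCommon := H.toCommon.insert le_rfl (by omega) le_rfl
    ⟨by simp only; omega, by have := H.x_le; simp only; omega, le_rfl⟩ (by omega)
    ⟨_, H.mem, by simp⟩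
  one_le := H.one_le
  m_le := by omega
  x_lt := by omega
  x₀_le := hx ▸ H.x_le
  row a := by
    rw [Set.mem_insert_iff, H.row, Prod.mk.injEq]; omega
  corner := by
    obtain ⟨y, hy, hc⟩ := H.corner
    exact ⟨y, hy, Or.inr hc⟩

theorem left_side (hx : x = x₀) (hm : x₀ = m) : SideInv (insert (x - 1, h) V) (x - 1) h h h where
  toCommon := H.toCommon.insert (by omega) (by omega) le_rfl
    ⟨le_rfl, by have := H.x_le; simp only; omega, le_rfl⟩ (by omega) ⟨_, H.mem, by simp⟩
  x_le := by have := H.x_le; omega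
  y_le := le_rfl
  y₁_le := le_rfl
  col b := by
    rw [Set.mem_insert_iff, Prod.mk.injEq]
    constructor
    · rintro (h | h)
      · omega
      · have := (H.bounds _ h).1
        simp only at this; omega
    · intro h; left; omega
  right _ := Or.inr ⟨x, by omega, Or.inr H.mem⟩

theorem right_ok : StepOK V (x, h) .right := by
  obtain ⟨y, hy, hc⟩ := H.corner
  refine ⟨?_, Or.inr (Or.inl fun v hv => by simpa [Step.vec] using (H.bounds v hv).2.2), ?_⟩
  · rintro ⟨a, b⟩ hv rfl
    exact ((H.row a).1 hv).2
  · intro _ hb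
    have := hb _ hc
    simp [Step.vec] at this; omega

theorem right_top (hx : x < 0) : TopInv (insert (x + 1, h) V) x₀ (x + 1) h m where
  toCommon := H.toCommon.insert le_rfl (by omega) le_rfl
    ⟨by have := H.m_le; have := H.x₀_le; simp only; omega, by simp only; omega, le_rfl⟩ (by omega)
    ⟨_, H.mem, by simp⟩
  one_le := H.one_le
  m_le := H.m_le
  x₀_le := by have := H.x₀_le; omega
  x_le := by omega
  row a := by
    have := H.x₀_le
    rw [Set.mem_insert_iff, H.row, Prod.mk.injEq]; omega
  below := Or.inr H.below
  corner := by
    obtain ⟨y, hy, hc⟩ := H.corner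
    exact ⟨y, hy, Or.inr hc⟩

theorem up_ok : StepOK V (x, h) .up := by
  refine ⟨fun v hv _ => (H.bounds v hv).2.2, Or.inr (Or.inl fun v hv => ?_), by simp⟩
  have := H.bounds v hv
  simp [Step.vec]; omega

theorem up_top : TopInv (insert (x, h + 1) V) x x (h + 1) m where
  toCommon := H.toCommon.insert le_rfl le_rfl (by omega)
    ⟨by have := H.m_le; have := H.x₀_le; simp only; omega, H.x_le, le_rfl⟩ (fun _ => rfl)
    ⟨_, H.mem, by simp only; omega⟩
  one_le := by have := H.one_le; omega
  m_le := H.m_le.trans H.x₀_le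
  x₀_le := le_rfl
  x_le := H.x_le
  row a := by
    rw [Set.mem_insert_iff, Prod.mk.injEq]
    constructor
    · rintro (h | h)
      · omega
      · have := (H.bounds _ h).2.2
        simp only at this; omega
    · intro h; left; omega
  below := Or.inr (by simpa using H.mem)
  corner := by
    obtain ⟨y, hy, hc⟩ := H.corner
    exact ⟨y, by omega, Or.inr hc⟩

/-- At `x₀` the vertex below is occupied. Elsewhere the end point of a down step is not on the top
side, and not on the left side because of `x₀`; being on the right side forces x = 0, and then the
origin blocks the step. -/
theorem down_not_ok : ¬ StepOK V (x, h) .down := by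
  rintro ⟨h1, h2, -⟩
  have h3 := H.x₀_le
  have h4 := H.one_le
  by_cases hx : x = x₀
  · have := h1 _ H.below hx.symm
    simp only at this; omega
  · rcases h2 with h2 | h2 | h2
    · have := h2 _ ((H.row x₀).2 ⟨le_rfl, h3⟩)
      simp [Step.vec] at this; omega
    · have := h2 _ H.mem
      simp [Step.vec] at this
    · have h5 := h2 _ H.origin
      have h6 := H.x_le
      simp [Step.vec] at h5
      have := h1 _ H.origin (by simp only; omega)
      simp only at this; omega

end TopInv

namespace BackInv

variable (H : BackInv V x₀ x h m)
include H

theorem mem : (x, h) ∈ V := (H.row x).2 ⟨le_rfl, H.x_lt.le⟩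

theorem left_ok : StepOK V (x, h) .left := by
  obtain ⟨y, hy, hc⟩ := H.corner
  refine ⟨?_, Or.inr (Or.inl fun v hv => by simpa [Step.vec] using (H.bounds v hv).2.2), ?_⟩
  · rintro ⟨a, b⟩ hv rfl
    exact ((H.row a).1 hv).1
  · intro _ hb
    have := hb _ hc
    simp [Step.vec] at this; omega

theorem left_back (hm : m < x) : BackInv (insert (x - 1, h) V) x₀ (x - 1) h m where
  toCommon := H.toCommon.insert le_rfl (by omega) le_rfl
    ⟨by simp only; omega, by have := H.x_lt; have := H.x₀_le; simp only; omega, le_rfl⟩ (by omega)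
    ⟨_, H.mem, by simp⟩
  one_le := H.one_le
  m_le := by omega
  x_lt := by have := H.x_lt; omega
  x₀_le := H.x₀_le
  row a := by
    have := H.x_lt
    rw [Set.mem_insert_iff, H.row, Prod.mk.injEq]; omega
  corner := by
    obtain ⟨y, hy, hc⟩ := H.corner
    exact ⟨y, hy, Or.inr hc⟩

theorem left_side (hm : x = m) : SideInv (insert (x - 1, h) V) (x - 1) h h h where
  toCommon := H.toCommon.insert (by omega) (by omega) le_rfl
    ⟨le_rfl, by have := H.x_lt; have := H.x₀_le; simp only; omega, le_rfl⟩ (by omega)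
    ⟨_, H.mem, by simp⟩
  x_le := by have := H.x_lt; have := H.x₀_le; omega
  y_le := le_rfl
  y₁_le := le_rfl
  col b := by
    rw [Set.mem_insert_iff, Prod.mk.injEq]
    constructor
    · rintro (h | h)
      · omega
      · have := (H.bounds _ h).1
        simp only at this; omega
    · intro h; left; omega
  right _ := Or.inr ⟨x, by omega, Or.inr H.mem⟩

theorem right_not_ok : ¬ StepOK V (x, h) .right := by
  intro hs
  have h0 := H.x_lt
  have := hs.1 _ ((H.row x₀).2 ⟨h0.le, le_rfl⟩) rfl
  simp only at this; omega

theorem up_ok : StepOK V (x, h) .up := by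
  refine ⟨fun v hv _ => (H.bounds v hv).2.2, Or.inr (Or.inl fun v hv => ?_), by simp⟩
  have := H.bounds v hv
  simp [Step.vec]; omega

theorem up_top : TopInv (insert (x, h + 1) V) x x (h + 1) m where
  toCommon := H.toCommon.insert le_rfl le_rfl (by omega)
    ⟨H.m_le, by have := H.x_lt; have := H.x₀_le; simp only; omega, le_rfl⟩ (fun _ => rfl)
    ⟨_, H.mem, by simp only; omega⟩
  one_le := by have := H.one_le; omega
  m_le := H.m_le
  x₀_le := le_rfl
  x_le := by have := H.x_lt; have := H.x₀_le; omega
  row a := by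
    rw [Set.mem_insert_iff, Prod.mk.injEq]
    constructor
    · rintro (h | h)
      · omega
      · have := (H.bounds _ h).2.2
        simp only at this; omega
    · intro h; left; omega
  below := Or.inr (by simpa using H.mem)
  corner := by
    obtain ⟨y, hy, hc⟩ := H.corner
    exact ⟨y, by omega, Or.inr hc⟩

/-- Only the left side of the box could receive the step, since `x₀` lies further right; but there
the vertex in `corner` blocks the way. -/
theorem down_not_ok : ¬ StepOK V (x, h) .down := by
  rintro ⟨h1, h2, -⟩
  have h3 := H.x_lt
  obtain ⟨y, hy, hc⟩ := H.corner
  rcases h2 with h2 | h2 | h2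
  · have h4 := h2 _ hc
    have h5 := H.m_le
    simp [Step.vec] at h4
    have := h1 _ hc (by simp only; omega)
    simp only at this; omega
  · have := h2 _ H.mem
    simp [Step.vec] at this
  · have := h2 _ ((H.row x₀).2 ⟨h3.le, le_rfl⟩)
    simp [Step.vec] at this; omega

end BackInv

namespace SideInv

variable (H : SideInv V x y h y₁)
include H

theorem mem : (x, y) ∈ V := (H.col y).2 (by omega)

theorem left_ok : StepOK V (x, y) .left := by
  refine ⟨fun v hv _ => (H.bounds v hv).1, Or.inl fun v hv => ?_, fun _ _ => Or.inl fun v hv => ?_⟩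
  all_goals
    have := (H.bounds v hv).1
    simp [Step.vec]; omega

theorem left_side : SideInv (insert (x - 1, y) V) (x - 1) y h y where
  toCommon := H.toCommon.insert (by omega) (by omega) le_rfl
    ⟨le_rfl, by have := H.x_le; simp only; omega, H.y_le⟩ (by omega) ⟨_, H.mem, by simp⟩
  x_le := by have := H.x_le; omega
  y_le := H.y_le
  y₁_le := H.y_le
  col b := by
    rw [Set.mem_insert_iff, Prod.mk.injEq]
    constructor
    · rintro (h | h)
      · omega
      · have := (H.bounds _ h).1
        simp only at this; omega
    · intro h; left; omega
  right _ := Or.inr ⟨x, by omega, Or.inr H.mem⟩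

/-- On the bottom level the step would violate the inflation condition, since it stays in the box;
on any other level a visited vertex lies to the right. -/
theorem right_not_ok (hx : x < 0) : ¬ StepOK V (x, y) .right := by
  rintro ⟨h1, -, h3⟩
  rcases H.right hx with h4 | ⟨a, ha, h4⟩
  · rcases h3 (Or.inr rfl) (by simpa [Step.vec] using h4) with h5 | h5 | h5 | h5
    · have := h5 _ H.mem; simp [Step.vec] at this
    · have := h5 _ H.origin; simp [Step.vec] at this; omega
    · have := h5 _ H.mem; simp [Step.vec] at this
    · have := h5 _ H.mem; simp [Step.vec] at this
  · have := h1 _ h4 rfl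
    simp only at this; omega

/-- If the new vertex is not on the bottom level, `level` provides a vertex in its row, and this
lies strictly to the right because the new vertex is unvisited and on the left side. -/
theorem right_of_not_mem {y' : ℤ} (hy' : y' ≤ h) (hn : (x, y') ∉ V) :
    (∀ v ∈ insert (x, y') V, y' ≤ v.2) ∨ ∃ a > x, (a, y') ∈ insert (x, y') V := by
  by_cases hb : ∀ v ∈ V, y' ≤ v.2
  · left
    rintro v (rfl | hv)
    · exact le_rfl
    · exact hb v hv
  · push Not at hb
    obtain ⟨v, hv, hv'⟩ := hb
    obtain ⟨a, ha⟩ := H.level v hv y' hv'.le hy'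
    have := (H.bounds _ ha).1
    refine Or.inr ⟨a, lt_of_le_of_ne this ?_, Or.inr ha⟩
    rintro rfl
    exact hn ha

theorem up_not_ok (hy : y < y₁) : ¬ StepOK V (x, y) .up := by
  intro hs
  have := hs.1 _ ((H.col y₁).2 (by omega)) rfl
  simp only at this; omega

theorem up_ok (hy : y₁ ≤ y) : StepOK V (x, y) .up := by
  refine ⟨?_, Or.inl fun v hv => by simpa [Step.vec] using (H.bounds v hv).1, by simp⟩
  rintro ⟨a, b⟩ hv rfl
  have := (H.col b).1 hv
  simp only; omega

theorem up_side (hy : y₁ ≤ y) (hh : y < h) : SideInv (insert (x, y + 1) V) x (y + 1) h y₁ where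
  toCommon := H.toCommon.insert le_rfl (by omega) le_rfl
    ⟨le_rfl, H.x_le, by simp only; omega⟩ (by omega) ⟨_, H.mem, by simp only; omega⟩
  x_le := H.x_le
  y_le := by omega
  y₁_le := H.y₁_le
  col b := by
    rw [Set.mem_insert_iff, H.col, Prod.mk.injEq]; omega
  right _ := H.right_of_not_mem (by omega) (by rw [H.col]; omega)

theorem up_top (hh : y = h) (h0 : 0 ≤ h) :
    TopInv (insert (x, y + 1) V) x x (h + 1) x where
  toCommon := H.toCommon.insert le_rfl (by omega) (by omega)
    ⟨le_rfl, H.x_le, by simp only; omega⟩ (fun _ => by simp only; omega)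
    ⟨_, H.mem, by simp only; omega⟩
  one_le := by omega
  m_le := le_rfl
  x₀_le := le_rfl
  x_le := H.x_le
  row a := by
    rw [Set.mem_insert_iff, Prod.mk.injEq]
    constructor
    · rintro (h | h)
      · omega
      · have := (H.bounds _ h).2.2
        simp only at this; omega
    · intro h; left; omega
  below := Or.inr (by simpa [hh] using H.mem)
  corner := ⟨y, by omega, Or.inr H.mem⟩

theorem down_not_ok (hy : y₁ < y) : ¬ StepOK V (x, y) .down := by
  intro hs
  have := hs.1 _ ((H.col y₁).2 (by omega)) rfl
  simp only at this; omega

theorem down_ok (hy : y ≤ y₁) : StepOK V (x, y) .down := by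
  refine ⟨?_, Or.inl fun v hv => by simpa [Step.vec] using (H.bounds v hv).1, by simp⟩
  rintro ⟨a, b⟩ hv rfl
  have := (H.col b).1 hv
  simp only; omega

theorem down_side (hy : y ≤ y₁) : SideInv (insert (x, y - 1) V) x (y - 1) h y₁ where
  toCommon := H.toCommon.insert le_rfl (by omega) le_rfl
    ⟨le_rfl, H.x_le, by have := H.y_le; simp only; omega⟩ (by omega)
    ⟨_, H.mem, by simp only; omega⟩
  x_le := H.x_le
  y_le := by have := H.y_le; omega
  y₁_le := H.y₁_le
  col b := by
    rw [Set.mem_insert_iff, H.col, Prod.mk.injEq]; omega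
  right _ := H.right_of_not_mem (by have := H.y_le; omega) (by rw [H.col]; omega)

end SideInv

end steps

/-! ### Encoding of walks in the left half-plane -/

/-- Codes for the walks in the left half-plane that end with a step to a new top level. Each
constructor appends a piece that starts on the top level `y = h` (at first: `y = 0`) and is followed
by an up step: `base l` and `beyond c l` leave the box and descend into columns whose depths below
the level `h` are recorded, last one first, in `l`; `right c r` and `left c r` make `r` (resp.
`r + 1`) steps to the right (resp. left) inside the box. -/
inductive Code
  | base (l : List ℕ)
  | beyond (c : Code) (l : List ℕ)
  | right (c : Code) (r : ℕ)
  | left (c : Code) (r : ℕ)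

/-- A sequence of vertical steps from depth `a` to depth `b`. -/
def vertical (a b : ℕ) : List Step :=
  List.replicate (b - a) .down ++ List.replicate (a - b) .up

/-- The walk that starts at depth `0`, makes left steps at the depths recorded (last one first) in
`l` and ends at depth `d`. -/
def descent : List ℕ → ℕ → List Step
  | [], d => vertical 0 d
  | a :: l, d => descent l a ++ [.left] ++ vertical a d

namespace Code

/-- Length and left gap of the top row of the polygon obtained by closing the walk. -/
def shape : Code → ℕ × ℕ
  | base l => (l.length + 1, 0)
  | beyond c l => (c.shape.1 + c.shape.2 + (l.length + 1), 0)
  | right c r => (c.shape.1 - r, c.shape.2 + r)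
  | left c r => (c.shape.1 + (r + 1), c.shape.2 - (r + 1))

/-- Length of the top row of the polygon obtained by closing the walk. -/
def top (c : Code) : ℕ := c.shape.1

/-- Left gap of the top row of the polygon obtained by closing the walk. -/
def gap (c : Code) : ℕ := c.shape.2

/-- The ordinate of the end point. -/
def height : Code → ℕ
  | base _ => 1
  | beyond c _ => c.height + 1
  | right c _ => c.height + 1
  | left c _ => c.height + 1

/-- The horizontal moves stay inside the box. -/
def Valid : Code → Prop
  | base _ => True
  | beyond c _ => c.Valid
  | right c r => c.Valid ∧ r < c.top
  | left c r => c.Valid ∧ r < c.gap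

/-- Half-perimeter of the polygon obtained by closing the walk. -/
def half : Code → ℕ
  | base l => barSize l + 2
  | beyond c l => c.half + c.gap + (barSize l + 2)
  | right c _ => c.half + 1
  | left c r => c.half + (r + 2)

/-- The walk with the given code. -/
def word : Code → List Step
  | base l => descent l 0 ++ [.up]
  | beyond c l => c.word ++ List.replicate (c.gap + 1) .left ++ descent l 0 ++ [.up]
  | right c r => c.word ++ List.replicate r .right ++ [.up]
  | left c r => c.word ++ List.replicate (r + 1) .left ++ [.up]

@[simp] theorem top_base (l : List ℕ) : (base l).top = l.length + 1 := rfl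
@[simp] theorem top_beyond (c : Code) (l : List ℕ) :
    (beyond c l).top = c.top + c.gap + (l.length + 1) := rfl
@[simp] theorem top_right (c : Code) (r : ℕ) : (right c r).top = c.top - r := rfl
@[simp] theorem top_left (c : Code) (r : ℕ) : (left c r).top = c.top + (r + 1) := rfl
@[simp] theorem gap_base (l : List ℕ) : (base l).gap = 0 := rfl
@[simp] theorem gap_beyond (c : Code) (l : List ℕ) : (beyond c l).gap = 0 := rfl
@[simp] theorem gap_right (c : Code) (r : ℕ) : (right c r).gap = c.gap + r := rfl
@[simp] theorem gap_left (c : Code) (r : ℕ) : (left c r).gap = c.gap - (r + 1) := rfl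

theorem Valid.top_pos {c : Code} (h : c.Valid) : 1 ≤ c.top := by
  induction c with
  | base l => simp
  | beyond c l ih => simp; omega
  | right c r ih => have := h.2; simp; omega
  | left c r ih => simp; omega

end Code

/-- States of a walk in the left half-plane: moving right on the top level, moving left on the top
level inside the box, or moving along the left side of the box. -/
inductive WalkState
  | top (c : Code) (r : ℕ)
  | back (c : Code) (r : ℕ)
  | side (o : Option Code) (l : List ℕ) (d : ℕ)

/-- The walk that has led to the left side of the box. -/
def preWord : Option Code → List Step
  | none => []
  | some c => c.word ++ List.replicate (c.gap + 1) .left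

/-- The code of a walk that returns from the left side of the box to a new top level. -/
def closeCode : Option Code → List ℕ → Code
  | none, l => .base l
  | some c, l => .beyond c l

namespace WalkState

/-- The walk leading to a state. -/
def word : WalkState → List Step
  | top c r => c.word ++ List.replicate r .right
  | back c r => c.word ++ List.replicate (r + 1) .left
  | side o l d => preWord o ++ descent l d

/-- The horizontal moves stay inside the box. -/
def Valid : WalkState → Prop
  | top c r => c.Valid ∧ r < c.top
  | back c r => c.Valid ∧ r < c.gap
  | side o _ _ => ∀ c ∈ o, c.Valid

/-- The transition between states made by a step. -/
def next : WalkState → Step → Option WalkState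
  | top c r, .right => if r + 1 < c.top then some (top c (r + 1)) else none
  | top c r, .up => some (top (.right c r) 0)
  | top c r, .left =>
    if r = 0 then if 0 < c.gap then some (back c 0) else some (side (some c) [] 0) else none
  | top _ _, .down => none
  | back _ _, .right => none
  | back c r, .up => some (top (.left c r) 0)
  | back c r, .left => if r + 1 < c.gap then some (back c (r + 1)) else some (side (some c) [] 0)
  | back _ _, .down => none
  | side _ _ _, .right => none
  | side o l d, .up =>
    if l.headD 0 < d then none
    else if d = 0 then some (top (closeCode o l) 0) else some (side o l (d - 1))
  | side o l d, .left => some (side o (d :: l) d)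
  | side o l d, .down => if d < l.headD 0 then none else some (side o l (d + 1))

theorem valid_closeCode {o : Option Code} (h : ∀ c ∈ o, c.Valid) (l : List ℕ) :
    (closeCode o l).Valid := by
  cases o with
  | none => trivial
  | some c => exact h c rfl

theorem valid_next {σ τ : WalkState} {s : Step} (hσ : σ.Valid) (h : σ.next s = some τ) :
    τ.Valid := by
  rcases σ with ⟨c, r⟩ | ⟨c, r⟩ | ⟨o, l, d⟩ <;> cases s <;>
    simp only [next, Option.ite_none_left_eq_some, Option.ite_none_right_eq_some, Option.some.injEq,
      reduceCtorEq] at h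
  · obtain ⟨rfl, h⟩ := h
    split_ifs at h with hg <;> cases h
    · exact ⟨hσ.1, hg⟩
    · rintro c' ⟨⟩; exact hσ.1
  · obtain ⟨h, rfl⟩ := h
    exact ⟨hσ.1, h⟩
  · subst h
    exact ⟨hσ, by have := hσ.2; simp; omega⟩
  · split_ifs at h with hg <;> cases h
    · exact ⟨hσ.1, hg⟩
    · rintro c' ⟨⟩; exact hσ.1
  · subst h
    exact ⟨hσ, by simp⟩
  · subst h; exact hσ
  · obtain ⟨-, h⟩ := h
    split_ifs at h with hg <;> cases h
    · exact ⟨valid_closeCode hσ l, (valid_closeCode hσ l).top_pos⟩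
    · exact hσ
  · obtain ⟨-, rfl⟩ := h; exact hσ

/-- Only the last vertical run depends on `d`. It starts at the depth of the latest left step; the
default 0 is the top level, where the excursion begins. -/
theorem descent_eq (l : List ℕ) :
    ∃ w, ∀ d, descent l d = w ++ vertical (l.headD 0) d := by
  cases l with
  | nil => exact ⟨[], fun d => rfl⟩
  | cons a l => exact ⟨descent l a ++ [.left], fun d => rfl⟩

theorem vertical_up {a d : ℕ} (h : d < a) : vertical a d = vertical a (d + 1) ++ [.up] := by
  have h1 : d - a = 0 := by omega
  have h2 : d + 1 - a = 0 := by omega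
  have h3 : a - d = a - (d + 1) + 1 := by omega
  simp [vertical, h1, h2, h3, List.replicate_succ']

theorem vertical_down {a d : ℕ} (h : a ≤ d) : vertical a (d + 1) = vertical a d ++ [.down] := by
  have h1 : a - d = 0 := by omega
  have h2 : a - (d + 1) = 0 := by omega
  have h3 : d + 1 - a = d - a + 1 := by omega
  simp [vertical, h1, h2, h3, List.replicate_succ']

theorem descent_up {l : List ℕ} {d : ℕ} (h : d < l.headD 0) :
    descent l d = descent l (d + 1) ++ [.up] := by
  obtain ⟨w, hw⟩ := descent_eq l
  rw [hw, hw, vertical_up h, List.append_assoc]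

theorem descent_down {l : List ℕ} {d : ℕ} (h : l.headD 0 ≤ d) :
    descent l (d + 1) = descent l d ++ [.down] := by
  obtain ⟨w, hw⟩ := descent_eq l
  rw [hw, hw, vertical_down h, List.append_assoc]

theorem descent_left (l : List ℕ) (d : ℕ) : descent (d :: l) d = descent l d ++ [.left] := by
  simp [descent, vertical]

theorem word_closeCode (o : Option Code) (l : List ℕ) :
    (closeCode o l).word = preWord o ++ descent l 0 ++ [.up] := by
  cases o <;> rfl

theorem word_next {σ τ : WalkState} {s : Step} (hσ : σ.Valid) (h : σ.next s = some τ) :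
    τ.word = σ.word ++ [s] := by
  rcases σ with ⟨c, r⟩ | ⟨c, r⟩ | ⟨o, l, d⟩ <;> cases s <;>
    simp only [next, Option.ite_none_left_eq_some, Option.ite_none_right_eq_some, Option.some.injEq,
      reduceCtorEq] at h
  · obtain ⟨rfl, h⟩ := h
    split_ifs at h with hg <;> cases h
    · simp [word]
    · simp [word, preWord, show c.gap = 0 by omega, descent, vertical]
  · obtain ⟨h, rfl⟩ := h
    simp [word, List.replicate_succ']
  · subst h
    simp [word, Code.word]
  · split_ifs at h with hg <;> cases h
    · simp [word, List.replicate_succ']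
    · have := hσ.2
      simp [word, preWord, show c.gap = r + 1 by omega, descent, vertical, List.replicate_succ']
  · subst h
    simp [word, Code.word]
  · subst h
    simp [word, descent_left]
  · obtain ⟨h', h⟩ := h
    split_ifs at h with hg <;> cases h
    · subst hg
      simp [word, word_closeCode]
    · rw [word, word, List.append_assoc, descent_up (d := d - 1) (by omega),
        Nat.sub_add_cancel (by omega)]
  · obtain ⟨h', rfl⟩ := h
    simp [word, descent_down (not_lt.1 h')]

/-! ### Reading walks with the automaton -/

/-- Reading a walk from a given state. -/
def runFrom (o : Option WalkState) (p : List Step) : Option WalkState :=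
  p.foldl (fun o s => o.bind fun σ => σ.next s) o

/-- The state of a walk that starts at the origin. -/
def run (p : List Step) : Option WalkState := runFrom (some (side none [] 0)) p

theorem runFrom_append (o : Option WalkState) (p q : List Step) :
    runFrom o (p ++ q) = runFrom (runFrom o p) q := List.foldl_append

theorem run_append (p q : List Step) : run (p ++ q) = runFrom (run p) q := runFrom_append _ _ _

theorem runFrom_singleton (σ : WalkState) (s : Step) : runFrom (some σ) [s] = σ.next s := rfl

theorem run_append_singleton (p : List Step) (s : Step) :
    run (p ++ [s]) = (run p).bind fun σ => σ.next s := by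
  rw [run_append]; rfl

/-- A state remembers the entire walk that led to it. -/
theorem run_eq_some {p : List Step} {σ : WalkState} (h : run p = some σ) :
    σ.Valid ∧ σ.word = p := by
  induction p using List.reverseRecOn generalizing σ with
  | nil => cases h; simp [Valid, word, preWord, descent, vertical]
  | append_singleton p s ih =>
    rw [run_append_singleton, Option.bind_eq_some_iff] at h
    obtain ⟨τ, hτ, h⟩ := h
    obtain ⟨h1, h2⟩ := ih hτ
    exact ⟨valid_next h1 h, by rw [word_next h1 h, h2]⟩

theorem runFrom_right (c : Code) {r : ℕ} (h : r < c.top) :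
    runFrom (some (top c 0)) (List.replicate r .right) = some (top c r) := by
  induction r with
  | zero => rfl
  | succ r ih =>
    rw [List.replicate_succ', runFrom_append, ih (by omega), runFrom_singleton, next, if_pos h]

theorem runFrom_left (c : Code) {r : ℕ} (h : r < c.gap) :
    runFrom (some (top c 0)) (List.replicate (r + 1) .left) = some (back c r) := by
  induction r with
  | zero => simp [runFrom, next, h]
  | succ r ih =>
    rw [List.replicate_succ', runFrom_append, ih (by omega), runFrom_singleton, next, if_pos h]

/-- The first `c.gap` left steps stay inside the box and the last one leaves it. With gap 0 the
intermediate state `back` does not occur. -/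
theorem runFrom_beyond (c : Code) :
    runFrom (some (top c 0)) (List.replicate (c.gap + 1) .left) = some (side (some c) [] 0) := by
  rcases hg : c.gap with _ | r
  · simp [runFrom, next, hg]
  · rw [List.replicate_succ', runFrom_append, runFrom_left c (by omega), runFrom_singleton, next,
      if_neg (by omega)]

theorem runFrom_vertical (o : Option Code) (l : List ℕ) (d : ℕ) :
    runFrom (some (side o l (l.headD 0))) (vertical (l.headD 0) d) = some (side o l d) := by
  rcases le_total d (l.headD 0) with h | h
  · obtain ⟨k, rfl⟩ : ∃ k, d = l.headD 0 - k := ⟨l.headD 0 - d, by omega⟩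
    induction k with
    | zero => simp [vertical, runFrom]
    | succ k ih =>
      rcases Nat.lt_or_ge k (l.headD 0) with h' | h'
      · have e : l.headD 0 - (k + 1) + 1 = l.headD 0 - k := by omega
        rw [vertical_up (by omega), runFrom_append, e, ih (by omega), runFrom_singleton, next,
          if_neg (by omega), if_neg (by omega)]
        rfl
      · rw [show l.headD 0 - (k + 1) = l.headD 0 - k by omega]
        exact ih (by omega)
  · induction d, h using Nat.le_induction with
    | base => simp [vertical, runFrom]
    | succ d h ih =>
      rw [vertical_down h, runFrom_append, ih, runFrom_singleton, next, if_neg (by omega)]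

theorem runFrom_descent (o : Option Code) (l : List ℕ) (d : ℕ) :
    runFrom (some (side o [] 0)) (descent l d) = some (side o l d) := by
  induction l generalizing d with
  | nil => exact runFrom_vertical o [] d
  | cons a l ih =>
    rw [descent, runFrom_append, runFrom_append, ih, runFrom_singleton]
    exact runFrom_vertical o (a :: l) d

theorem run_code {c : Code} (h : c.Valid) : run c.word = some (top c 0) := by
  induction c with
  | base l =>
    rw [Code.word, run_append, run, runFrom_descent, runFrom_singleton, next, if_neg (by omega),
      if_pos rfl]
    rfl
  | beyond c l ih =>
    rw [Code.word, run_append, run_append, run_append, ih h, runFrom_beyond, runFrom_descent,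
      runFrom_singleton, next, if_neg (by omega), if_pos rfl]
    rfl
  | right c r ih =>
    rw [Code.word, run_append, run_append, ih h.1, runFrom_right c h.2, runFrom_singleton, next]
  | left c r ih =>
    rw [Code.word, run_append, run_append, ih h.1, runFrom_left c h.2, runFrom_singleton, next]

/-- The automaton is deterministic and reading the word ends in `top c 0`, which displays the code.
-/
theorem code_word_injective {c c' : Code} (h : c.Valid) (h' : c'.Valid) (e : c.word = c'.word) :
    c = c' := by
  have := run_code h
  rw [e, run_code h'] at this
  simpa using this.symm

end WalkState

/-! ### Geometric meaning of the states -/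

namespace WalkState

/-- The abscissa of the left side of the box after the left steps of a descent. -/
def sideX : Option Code → List ℕ → ℤ
  | none, l => -l.length
  | some c, l => -(c.top + c.gap) - l.length

/-- The ordinate of the top side of the box. -/
def sideY : Option Code → ℕ
  | none => 0
  | some c => c.height

/-- The position of the end point. -/
def point : WalkState → ℤ × ℤ
  | top c r => (1 - c.top + r, c.height)
  | back c r => (1 - c.top - (r + 1), c.height)
  | side o l d => (sideX o l, sideY o - d)

/-- The description of the set of vertices of the walk that leads to a state. -/
def Inv (V : Set (ℤ × ℤ)) : WalkState → Prop
  | top c r => TopInv V (1 - c.top) (1 - c.top + r) c.height (1 - c.top - c.gap)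
  | back c r => BackInv V (1 - c.top) (1 - c.top - (r + 1)) c.height (1 - c.top - c.gap)
  | side o l d => SideInv V (sideX o l) (sideY o - d) (sideY o) (sideY o - l.headD 0)

theorem sideX_cons (o : Option Code) (a : ℕ) (l : List ℕ) : sideX o (a :: l) = sideX o l - 1 := by
  cases o <;> simp [sideX] <;> ring

theorem top_closeCode (o : Option Code) (l : List ℕ) :
    ((closeCode o l).top : ℤ) = 1 - sideX o l := by
  cases o <;> simp [sideX, closeCode] <;> ring

theorem gap_closeCode (o : Option Code) (l : List ℕ) : (closeCode o l).gap = 0 := by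
  cases o <;> rfl

theorem height_closeCode (o : Option Code) (l : List ℕ) :
    (closeCode o l).height = sideY o + 1 := by
  cases o <;> rfl

theorem _root_.PrudentPolygons.TopInv.cast {V : Set (ℤ × ℤ)} {a b x₀ x h m a' b' x₀' x' h' m' : ℤ}
    (H : TopInv (insert (a, b) V) x₀ x h m)
    (e : a' = a ∧ b' = b ∧ x₀' = x₀ ∧ x' = x ∧ h' = h ∧ m' = m) :
    TopInv (insert (a', b') V) x₀' x' h' m' := by
  obtain ⟨rfl, rfl, rfl, rfl, rfl, rfl⟩ := e; exact H

theorem _root_.PrudentPolygons.BackInv.cast {V : Set (ℤ × ℤ)} {a b x₀ x h m a' b' x₀' x' h' m' : ℤ}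
    (H : BackInv (insert (a, b) V) x₀ x h m)
    (e : a' = a ∧ b' = b ∧ x₀' = x₀ ∧ x' = x ∧ h' = h ∧ m' = m) :
    BackInv (insert (a', b') V) x₀' x' h' m' := by
  obtain ⟨rfl, rfl, rfl, rfl, rfl, rfl⟩ := e; exact H

theorem _root_.PrudentPolygons.SideInv.cast {V : Set (ℤ × ℤ)} {a b x y h y₁ a' b' x' y' h' y₁' : ℤ}
    (H : SideInv (insert (a, b) V) x y h y₁)
    (e : a' = a ∧ b' = b ∧ x' = x ∧ y' = y ∧ h' = h ∧ y₁' = y₁) :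
    SideInv (insert (a', b') V) x' y' h' y₁' := by
  obtain ⟨rfl, rfl, rfl, rfl, rfl, rfl⟩ := e; exact H

/-- Soundness of a single transition: it is a legal step, and the geometric description of the
visited set carries over to the new state. -/
theorem next_spec {V : Set (ℤ × ℤ)} {σ τ : WalkState} {s : Step} (hv : σ.Valid) (H : σ.Inv V)
    (h : σ.next s = some τ) :
    StepOK V σ.point s ∧ τ.point = σ.point + s.vec ∧ τ.Inv (insert τ.point V) := by
  rcases σ with ⟨c, r⟩ | ⟨c, r⟩ | ⟨o, l, d⟩ <;> cases s <;>
    simp only [next, Option.ite_none_left_eq_some, Option.ite_none_right_eq_some, Option.some.injEq,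
      reduceCtorEq] at h
  · obtain ⟨rfl, h⟩ := h
    refine ⟨TopInv.left_ok H (by simp), ?_⟩
    split_ifs at h with hg <;> cases h
    · have := TopInv.left_back H (by simp) (by omega)
      simp only [Nat.cast_zero, add_zero] at this
      refine ⟨by simp [point, Step.vec]; ring, ?_⟩
      simpa [Inv, point] using this
    · have := TopInv.left_side H (by simp) (by omega)
      simp only [Nat.cast_zero, add_zero] at this
      have e : (1 - (c.top : ℤ) - 1) = -(c.top + c.gap) := by omega
      rw [e] at this
      refine ⟨by simp [point, Step.vec, sideX, sideY]; omega, ?_⟩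
      simpa [Inv, point, sideX, sideY] using this
  · obtain ⟨h, rfl⟩ := h
    refine ⟨TopInv.right_ok H, by simp [point, Step.vec]; ring, ?_⟩
    have := TopInv.right_top H (by omega)
    simpa [Inv, point, add_assoc] using this
  · subst h
    refine ⟨TopInv.up_ok H, ?_⟩
    have := TopInv.up_top H
    have hr := hv.2
    have e1 : ((c.top - r : ℕ) : ℤ) = c.top - r := by omega
    refine ⟨by simp [point, Step.vec, e1, Code.height]; ring, ?_⟩
    simp only [Inv, point, Code.top_right, Code.gap_right, Code.height, e1]
    exact this.cast (by omega)
  · refine ⟨BackInv.left_ok H, ?_⟩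
    split_ifs at h with hg <;> cases h
    · have := BackInv.left_back H (by omega)
      refine ⟨by simp [point, Step.vec]; ring, ?_⟩
      simp only [Inv, point]
      exact this.cast (by omega)
    · have hr := hv.2
      have := BackInv.left_side H (by omega)
      have e : (1 - (c.top : ℤ) - (r + 1) - 1) = -(c.top + c.gap) := by omega
      rw [e] at this
      refine ⟨by simp [point, Step.vec, sideX, sideY]; omega, ?_⟩
      simpa [Inv, point, sideX, sideY] using this
  · subst h
    refine ⟨BackInv.up_ok H, ?_⟩
    have := BackInv.up_top H
    have hr := hv.2
    have e1 : ((c.gap - (r + 1) : ℕ) : ℤ) = c.gap - (r + 1) := by omega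
    refine ⟨by simp [point, Step.vec, Code.height]; ring, ?_⟩
    simp only [Inv, point, Code.top_left, Code.gap_left, Code.height, e1]
    exact this.cast (by omega)
  · subst h
    refine ⟨SideInv.left_ok H, by simp [point, Step.vec, sideX_cons]; ring, ?_⟩
    simpa [Inv, point, sideX_cons] using SideInv.left_side H
  · obtain ⟨h', h⟩ := h
    refine ⟨SideInv.up_ok H (by omega), ?_⟩
    split_ifs at h with hg <;> cases h
    · subst hg
      have := SideInv.up_top H (by simp) (by positivity)
      refine ⟨by simp [point, Step.vec, top_closeCode, height_closeCode], ?_⟩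
      simpa [Inv, point, top_closeCode, height_closeCode, gap_closeCode] using this
    · have := SideInv.up_side H (by omega) (by omega)
      have e : ((d - 1 : ℕ) : ℤ) = d - 1 := by omega
      refine ⟨by simp [point, Step.vec, e]; ring, ?_⟩
      simp only [Inv, point, e]
      exact this.cast (by omega)
  · obtain ⟨h', rfl⟩ := h
    refine ⟨SideInv.down_ok H (by omega), by simp [point, Step.vec]; ring, ?_⟩
    have := SideInv.down_side H (by omega)
    simp only [Inv, point]
    exact this.cast (by omega)

/-- Completeness of the transitions: each missing one is either illegal by the invariant or leaves
the half-plane x ≤ 0. -/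
theorem exists_next {V : Set (ℤ × ℤ)} {σ : WalkState} {s : Step} (H : σ.Inv V)
    (hs : StepOK V σ.point s) (hx : (σ.point + s.vec).1 ≤ 0) : ∃ τ, σ.next s = some τ := by
  rcases σ with ⟨c, r⟩ | ⟨c, r⟩ | ⟨o, l, d⟩ <;> cases s <;> simp only [next]
  · rw [if_pos]
    · split_ifs <;> exact ⟨_, rfl⟩
    · by_contra hr
      exact TopInv.left_not_ok H (by omega) hs
  · simp only [point, Step.vec, Prod.mk_add_mk] at hx
    rw [if_pos (by omega)]; exact ⟨_, rfl⟩
  · exact ⟨_, rfl⟩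
  · exact (TopInv.down_not_ok H hs).elim
  · split_ifs <;> exact ⟨_, rfl⟩
  · exact (BackInv.right_not_ok H hs).elim
  · exact ⟨_, rfl⟩
  · exact (BackInv.down_not_ok H hs).elim
  · exact ⟨_, rfl⟩
  · simp only [point, Step.vec, Prod.mk_add_mk] at hx
    exact (SideInv.right_not_ok H (by omega) hs).elim
  · rw [if_neg]
    · split_ifs <;> exact ⟨_, rfl⟩
    · intro h
      exact SideInv.up_not_ok H (by omega) hs
  · rw [if_neg]
    · exact ⟨_, rfl⟩
    · intro h
      exact SideInv.down_not_ok H (by omega) hs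

theorem run_spec {p : List Step} {σ : WalkState} (h : run p = some σ) :
    IsThreeSided p ∧ pos p p.length = σ.point ∧ σ.Inv (visited p) := by
  induction p using List.reverseRecOn generalizing σ with
  | nil =>
    cases h
    refine ⟨isThreeSided_nil, by simp [pos, point, sideX, sideY]; rfl, ?_⟩
    refine ⟨⟨by simp [visited_nil], by simp [visited_nil, sideX, sideY], ?_⟩, ?_, ?_, ?_, ?_, ?_⟩
    · simp only [visited_nil, Set.mem_singleton_iff, sideY]
      rintro v rfl b h1 h2
      exact ⟨0, by simp only at h1; simp only [Prod.mk.injEq, true_and]; omega⟩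
    all_goals simp [visited_nil, sideX, sideY]
    intro b; omega
  | append_singleton p s ih =>
    rw [run_append_singleton, Option.bind_eq_some_iff] at h
    obtain ⟨τ, hτ, h⟩ := h
    obtain ⟨h1, h2, h3⟩ := ih hτ
    obtain ⟨h4, h5, h6⟩ := next_spec (run_eq_some hτ).1 h3 h
    have hlast : pos (p ++ [s]) (p ++ [s]).length = σ.point := by
      rw [List.length_append, pos_append_add, h2, h5]; simp [pos]
    refine ⟨?_, hlast, ?_⟩
    · rw [isThreeSided_append_singleton, h2]
      exact ⟨h1, h4⟩
    · rwa [visited_append_singleton, h2, ← h5]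

/-- Three-sided walks in the left half-plane are the walks with a state. -/
theorem exists_run {p : List Step} (h : IsThreeSided p) (hx : ∀ v ∈ visited p, v.1 ≤ 0) :
    ∃ σ, run p = some σ := by
  induction p using List.reverseRecOn with
  | nil => exact ⟨_, rfl⟩
  | append_singleton p s ih =>
    rw [isThreeSided_append_singleton] at h
    rw [visited_append_singleton] at hx
    obtain ⟨σ, hσ⟩ := ih h.1 fun v hv => hx v (Or.inr hv)
    obtain ⟨-, h2, h3⟩ := run_spec hσ
    obtain ⟨τ, hτ⟩ := exists_next h3 (h2 ▸ h.2) (h2 ▸ hx _ (Or.inl rfl))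
    exact ⟨τ, by rw [run_append_singleton, hσ, Option.bind_some, hτ]⟩

end WalkState

open WalkState

/-! ### Generic polygons -/

theorem pos_replicate (a : ℕ) (s : Step) {i : ℕ} (hi : i ≤ a) :
    pos (List.replicate a s) i = i • s.vec := by
  simp [pos, List.take_replicate, hi]

theorem pos_append_length (p q : List Step) :
    pos (p ++ q) (p ++ q).length = pos p p.length + pos q q.length := by
  rw [List.length_append, pos_append_add]

theorem pos_mem_visited {p : List Step} {i : ℕ} (hi : i ≤ p.length) : pos p i ∈ visited p :=
  ⟨i, hi, rfl⟩

theorem visited_append_replicate_down {p : List Step} {x y : ℤ} (h : pos p p.length = (x, y))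
    (k : ℕ) : visited (p ++ List.replicate k Step.down) =
      visited p ∪ {v | v.1 = x ∧ y - k ≤ v.2 ∧ v.2 < y} := by
  induction k with
  | zero =>
    ext v
    simp only [List.replicate_zero, List.append_nil, Nat.cast_zero, sub_zero, Set.mem_union,
      Set.mem_ofPred_eq]
    constructor
    · exact Or.inl
    · rintro (h | h)
      · exact h
      · omega
  | succ k ih =>
    have hlast : pos (p ++ List.replicate k Step.down) (p ++ List.replicate k Step.down).length =
        (x, y - k) := by
      rw [pos_append_length, h, List.length_replicate, pos_replicate _ _ le_rfl]
      simp [Step.vec]; ring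
    rw [List.replicate_succ', ← List.append_assoc, visited_append_singleton, ih, hlast]
    ext ⟨a, b⟩
    simp only [Step.vec, Prod.mk_add_mk, Set.mem_insert_iff, Prod.mk.injEq, Set.mem_union,
      Set.mem_ofPred_eq]
    push_cast
    constructor
    · rintro (h | h | h)
      · right; omega
      · exact Or.inl h
      · right; omega
    · rintro (h | h)
      · exact Or.inr (Or.inl h)
      · by_cases hb : b = y - k - 1
        · left; omega
        · right; right; omega

/-! ### The polygon obtained by closing a code -/

namespace Code

theorem length_descent (l : List ℕ) (d : ℕ) :
    (descent l d).length = l.length + verticalEdges d l := by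
  induction l generalizing d with
  | nil => simp [descent, vertical, verticalEdges]
  | cons a l ih =>
    simp only [descent, vertical, List.length_append, ih, verticalEdges, List.length_cons,
      List.length_nil, List.length_replicate, Nat.dist]
    omega

/-- Closing the walk adds `c.top` right steps, `c.height` down steps and the closing edge. -/
theorem length_word {c : Code} (h : c.Valid) :
    c.word.length + c.top + c.height + 1 = 2 * c.half := by
  induction c with
  | base l =>
    simp only [word, List.length_append, length_descent, verticalEdges_eq, List.length_singleton,
      top_base, height, half, barSize]
    omega
  | beyond c l ih =>
    have := ih h
    simp only [word, List.length_append, length_descent, verticalEdges_eq, List.length_singleton,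
      List.length_replicate, top_beyond, height, half, barSize]
    omega
  | right c r ih =>
    have := ih h.1
    have := h.2
    simp only [word, List.length_append, List.length_singleton, List.length_replicate, top_right,
      height, half]
    omega
  | left c r ih =>
    have := ih h.1
    simp only [word, List.length_append, List.length_singleton, List.length_replicate, top_left,
      height, half]
    omega

theorem height_pos (c : Code) : 1 ≤ c.height := by
  cases c <;> simp [height]

/-- The polygon obtained by closing the walk with code `c`. -/
def polygon (c : Code) : List Step :=
  c.word ++ List.replicate c.top .right ++ List.replicate c.height .down

/-- The part of the polygon in the left half-plane. -/
def leftPart (c : Code) : List Step := c.word ++ List.replicate (c.top - 1) .right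

theorem polygon_eq {c : Code} (h : c.Valid) :
    c.polygon = c.leftPart ++ [Step.right] ++ List.replicate c.height .down := by
  have := h.top_pos
  obtain ⟨k, hk⟩ : ∃ k, c.top = k + 1 := ⟨c.top - 1, by omega⟩
  rw [polygon, leftPart, hk, List.replicate_succ', Nat.add_sub_cancel]
  simp

section

variable {c : Code} (h : c.Valid)
include h

theorem run_leftPart : run c.leftPart = some (.top c (c.top - 1)) := by
  have := h.top_pos
  rw [leftPart, run_append, run_code h, runFrom_right c (by omega)]

theorem leftPart_spec : IsThreeSided c.leftPart ∧
    pos c.leftPart c.leftPart.length = (0, (c.height : ℤ)) ∧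
    TopInv (visited c.leftPart) (1 - c.top) 0 c.height (1 - c.top - c.gap) := by
  have := h.top_pos
  have e : 1 - (c.top : ℤ) + (c.top - 1 : ℕ) = 0 := by omega
  have := run_spec (run_leftPart h)
  rwa [WalkState.Inv, point, e] at this

theorem pos_leftPart_right : pos (c.leftPart ++ [Step.right]) (c.leftPart ++ [Step.right]).length =
    (1, (c.height : ℤ)) := by
  rw [pos_append_length, (leftPart_spec h).2.1]
  simp [pos, Step.vec]

theorem visited_polygon : visited c.polygon =
    visited c.leftPart ∪ {v | v.1 = 1 ∧ 0 ≤ v.2 ∧ v.2 ≤ c.height} := by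
  rw [polygon_eq h, visited_append_replicate_down (pos_leftPart_right h), visited_append_singleton,
    (leftPart_spec h).2.1]
  ext ⟨a, b⟩
  simp only [Step.vec, Prod.mk_add_mk, Set.mem_insert_iff, Prod.mk.injEq, Set.mem_union,
    Set.mem_ofPred_eq]
  constructor
  · rintro ((h | h) | h)
    · right; omega
    · exact Or.inl h
    · right; omega
  · rintro (h | h)
    · exact Or.inl (Or.inr h)
    · by_cases hb : b = c.height
      · left; left; omega
      · right; omega

/-- The line x = 1 is the right side of the box throughout the descent, and every visited vertex on
it is at or above the current end point. So each further down step is legal. -/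
theorem isThreeSided_polygon_aux (k : ℕ) :
    IsThreeSided (c.leftPart ++ [Step.right] ++ List.replicate k Step.down) := by
  obtain ⟨h1, h2, h3⟩ := leftPart_spec h
  induction k with
  | zero =>
    rw [List.replicate_zero, List.append_nil, isThreeSided_append_singleton, h2]
    exact ⟨h1, h3.right_ok⟩
  | succ k ih =>
    have hb : ∀ v ∈ visited (c.leftPart ++ [Step.right] ++ List.replicate k Step.down),
        v.1 ≤ 0 ∨ v.1 = 1 ∧ c.height - k ≤ v.2 := by
      rw [visited_append_replicate_down (pos_leftPart_right h), visited_append_singleton, h2]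
      rintro v ((rfl | hv) | hv)
      · right; simp [Step.vec]
      · exact Or.inl (h3.bounds v hv).2.1
      · exact Or.inr ⟨hv.1, hv.2.1⟩
    rw [List.replicate_succ', ← List.append_assoc, isThreeSided_append_singleton,
      pos_append_length, pos_leftPart_right h, List.length_replicate, pos_replicate _ _ le_rfl]
    refine ⟨ih, ?_, Or.inr (Or.inr ?_), by simp⟩
    · rintro v hv e
      have := hb v hv
      simp [Step.vec] at e ⊢
      omega
    · intro v hv
      have := hb v hv
      simp [Step.vec]
      omega

theorem isGenericPolygon_polygon : IsGenericPolygon c.polygon := by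
  have hh := c.height_pos
  refine ⟨?_, ?_, ?_⟩
  · rw [polygon_eq h]
    exact isThreeSided_polygon_aux h _
  · rw [polygon_eq h, pos_append_length, pos_leftPart_right h, List.length_replicate,
      pos_replicate _ _ le_rfl]
    simp [Step.vec]
  · obtain ⟨k, hk⟩ : ∃ k, c.height = k + 1 := ⟨c.height - 1, by omega⟩
    have hl : c.polygon.length - 1 = (c.leftPart ++ [Step.right]).length + k := by
      rw [polygon_eq h, List.length_append, List.length_replicate, hk]; omega
    rw [hl, polygon_eq h, pos_append_add, pos_leftPart_right h, pos_replicate _ _ (by omega), hk]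
    simp [Step.vec]

theorem yMax_polygon : yMax c.polygon = c.height := by
  have hv := visited_polygon h
  obtain ⟨-, h2, h3⟩ := leftPart_spec h
  apply le_antisymm
  · refine Finset.sup'_le _ _ fun i hi => ?_
    have : pos c.polygon i ∈ visited c.polygon :=
      pos_mem_visited (by rw [Finset.mem_range] at hi; omega)
    rw [hv] at this
    rcases this with h | h
    · exact (h3.bounds _ h).2.2
    · exact h.2.2
  · have : ((1 : ℤ), (c.height : ℤ)) ∈ visited c.polygon := by rw [hv]; right; simp
    obtain ⟨j, hj, e⟩ := this
    have := Finset.le_sup' (fun i => (pos c.polygon i).2)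
      (Finset.mem_range.2 (show j < c.polygon.length + 1 by omega))
    rwa [e] at this

theorem xMax_polygon : xMax c.polygon = 1 := by
  have hv := visited_polygon h
  obtain ⟨-, h2, h3⟩ := leftPart_spec h
  apply le_antisymm
  · refine Finset.sup'_le _ _ fun i hi => ?_
    have : pos c.polygon i ∈ visited c.polygon :=
      pos_mem_visited (by rw [Finset.mem_range] at hi; omega)
    rw [hv] at this
    rcases this with h | h
    · have := (h3.bounds _ h).2.1; omega
    · exact h.1.le
  · have : ((1 : ℤ), (c.height : ℤ)) ∈ visited c.polygon := by rw [hv]; right; simp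
    obtain ⟨j, hj, e⟩ := this
    have := Finset.le_sup' (fun i => (pos c.polygon i).1)
      (Finset.mem_range.2 (show j < c.polygon.length + 1 by omega))
    rwa [e] at this

theorem xMin_polygon : xMin c.polygon = 1 - c.top - c.gap := by
  have hv := visited_polygon h
  obtain ⟨-, h2, h3⟩ := leftPart_spec h
  apply le_antisymm
  · obtain ⟨y, -, hy⟩ := h3.corner
    have : ((1 - c.top - c.gap : ℤ), y) ∈ visited c.polygon := by rw [hv]; exact Or.inl hy
    obtain ⟨j, hj, e⟩ := this
    have := Finset.inf'_le (fun i => (pos c.polygon i).1)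
      (Finset.mem_range.2 (show j < c.polygon.length + 1 by omega))
    rwa [e] at this
  · refine Finset.le_inf' _ _ fun i hi => ?_
    have : pos c.polygon i ∈ visited c.polygon :=
      pos_mem_visited (by rw [Finset.mem_range] at hi; omega)
    rw [hv] at this
    rcases this with h | h
    · exact (h3.bounds _ h).1
    · rw [h.1]; omega

theorem hasTopGap_polygon (j : ℕ) : HasTopGap c.polygon j ↔ c.gap = j := by
  have hv := visited_polygon h
  obtain ⟨-, h2, h3⟩ := leftPart_spec h
  have hleast : IsLeast {x : ℤ | ∃ i ≤ c.polygon.length, pos c.polygon i = (x, yMax c.polygon)}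
      (1 - c.top) := by
    rw [yMax_polygon h]
    change IsLeast {x : ℤ | (x, (c.height : ℤ)) ∈ visited c.polygon} (1 - c.top)
    rw [hv]
    have htop := h.top_pos
    constructor
    · exact Or.inl ((h3.row _).2 (by omega))
    · rintro x (hx | hx)
      · exact ((h3.row _).1 hx).1
      · have := hx.1
        simp only at this; omega
  rw [HasTopGap, xMin_polygon h]
  constructor
  · intro hj
    have := hj.unique hleast
    omega
  · rintro rfl
    convert hleast using 1
    ring

theorem topRowLength_polygon : topRowLength c.polygon = c.top := by
  have htop := h.top_pos
  obtain ⟨hw1, hw2, hw3⟩ := run_spec (run_code h)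
  have hw3 : TopInv _ _ _ _ _ := hw3
  simp only [point, Nat.cast_zero, add_zero] at hw2 hw3
  have hlen : c.polygon.length = c.word.length + c.top + c.height := by
    simp [polygon]; omega
  have hp1 : ∀ i ≤ c.word.length, pos c.polygon i = pos c.word i := fun i hi => by
    rw [polygon, List.append_assoc, pos_append_of_le _ hi]
  have hp2 : ∀ k ≤ c.top, (pos c.polygon (c.word.length + k)).2 = c.height := fun k hk => by
    rw [polygon, List.append_assoc, pos_append_add, hw2, pos_append_of_le _ (by simpa using hk),
      pos_replicate _ _ hk]
    simp [Step.vec]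
  have hp3 : ∀ k ≤ c.height, (pos c.polygon (c.word.length + c.top + k)).2 = c.height - k :=
    fun k hk => by
      have e : c.word.length + c.top + k =
        (c.word ++ List.replicate c.top Step.right).length + k := by simp
      rw [e, polygon, pos_append_add, pos_append_length, hw2, List.length_replicate,
        pos_replicate _ _ le_rfl, pos_replicate _ _ hk]
      simp [Step.vec]; ring
  have : ((Finset.range c.polygon.length).filter fun i =>
      (pos c.polygon i).2 = yMax c.polygon ∧ (pos c.polygon (i + 1)).2 = yMax c.polygon) =
      Finset.Ico c.word.length (c.word.length + c.top) := by
    ext i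
    rw [Finset.mem_filter, Finset.mem_range, Finset.mem_Ico, yMax_polygon h, hlen]
    constructor
    · rintro ⟨h1, h2, h3⟩
      constructor
      · by_contra hi
        push Not at hi
        rw [hp1 i hi.le] at h2
        have hm := pos_mem_visited (p := c.word) hi.le
        rw [← Prod.mk.eta (p := pos c.word i), h2, hw3.row] at hm
        -- At its end the word meets the top row in a single vertex, so an earlier vertex on that
        -- row would be a second visit to the end point.
        refine hw1.1.pos_ne hi le_rfl ?_
        rw [hw2]
        exact Prod.ext (by simp only; omega) h2
      · by_contra hi
        push Not at hi
        obtain ⟨k, rfl⟩ := Nat.exists_eq_add_of_le hi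
        rw [add_assoc, hp3 (k + 1) (by omega)] at h3
        omega
    · rintro ⟨h1, h2⟩
      obtain ⟨k, rfl⟩ := Nat.exists_eq_add_of_le h1
      exact ⟨by omega, hp2 k (by omega), hp2 (k + 1) (by omega)⟩
  rw [topRowLength, this]
  simp

theorem hasHalfPerimeter_polygon (n : ℕ) : HasHalfPerimeter c.polygon n ↔ c.half = n := by
  have := length_word h
  rw [HasHalfPerimeter, polygon]
  simp only [List.length_append, List.length_replicate]
  omega

end

/-- The polygon determines `top` and `height` as its top row length and highest ordinate. Hence the
closing steps can be stripped off, which leaves the word. -/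
theorem polygon_injOn : Set.InjOn polygon {c | c.Valid} := by
  intro c h c' h' e
  have e1 := topRowLength_polygon h
  have e2 := yMax_polygon h
  rw [e, topRowLength_polygon h'] at e1
  rw [e, yMax_polygon h', Nat.cast_inj] at e2
  refine code_word_injective h h' ?_
  rw [polygon, polygon, e1, e2] at e
  exact List.append_cancel_right (List.append_cancel_right e)

end Code

open WalkState

/-! ### Every generic polygon comes from a code -/

theorem visited_take (p : List Step) {i : ℕ} (hi : i ≤ p.length) {v : ℤ × ℤ} :
    v ∈ visited (p.take i) ↔ ∃ j ≤ i, pos p j = v := by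
  have hpos : ∀ j ≤ i, pos (p.take i) j = pos p j := fun j hj => by
    simp [pos, List.take_take, hj]
  simp only [visited, Set.mem_ofPred_eq, List.length_take, min_eq_left hi]
  exact exists_congr fun j => and_congr_right fun hj => by rw [hpos j hj]

theorem pos_take_length (p : List Step) {i : ℕ} (hi : i ≤ p.length) :
    pos (p.take i) (p.take i).length = pos p i := by
  simp [pos, List.take_take, hi]

/-- A generic polygon stays to the left of the line `x = 1`. -/
theorem IsGenericPolygon.pos_fst_le {p : List Step} (h : IsGenericPolygon p) {j : ℕ}
    (hj : j ≤ p.length) : (pos p j).1 ≤ 1 := by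
  obtain ⟨⟨-, h1⟩, h2, h3⟩ := h
  have hn : 0 < p.length := by
    by_contra h0
    rw [show p.length = 0 by omega] at h2
    simp [pos, Prod.ext_iff] at h2
  have hs := (h1 (p.length - 1) (by omega)).1
  rw [Nat.sub_add_cancel hn] at hs
  -- The last vertex is not on the left side because of the origin, nor on the top side because of
  -- (1, 1); so it is on the right side.
  rcases hs with hs | hs | hs
  · have := hs 0 (Nat.zero_le _)
    rw [h2] at this
    simp [pos] at this
  · have := hs (p.length - 1) (by omega)
    rw [h2, h3] at this
    simp at this
  · have := hs j hj
    rwa [h2] at this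

theorem pos_zero (p : List Step) : pos p 0 = (0, 0) := by
  simp [pos]; rfl

/-- A generic polygon crosses to the line `x = 1` exactly once, at a positive height, at the end of
a walk with a code. -/
theorem IsGenericPolygon.exists_crossing {p : List Step} (h : IsGenericPolygon p) :
    ∃ i, ∃ hi : i < p.length, (∀ j ≤ i, (pos p j).1 ≤ 0) ∧ p[i] = .right ∧
      ∃ c : Code, c.Valid ∧ p.take i = c.leftPart := by
  have h' := h
  obtain ⟨h1, h2, h3⟩ := h
  have hex : ∃ j, j ≤ p.length ∧ 1 ≤ (pos p j).1 := ⟨p.length, le_rfl, by rw [h2]⟩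
  classical
  obtain ⟨hf1, hf2⟩ := Nat.find_spec hex
  have hmin : ∀ j < Nat.find hex, (pos p j).1 ≤ 0 := fun j hj => by
    have := Nat.find_min hex hj
    simp only [not_and, not_le] at this
    have := this (by omega)
    omega
  obtain ⟨i, hi⟩ : ∃ i, Nat.find hex = i + 1 := by
    refine ⟨Nat.find hex - 1, ?_⟩
    rcases hk : Nat.find hex with _ | k
    · rw [hk, pos_zero] at hf2; simp at hf2
    · rfl
  rw [hi] at hf1 hf2 hmin
  have hstep := pos_succ (p := p) (i := i) (by omega)
  have hle := hmin i (by omega)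
  have hright : p[i]'(by omega) = .right ∧ (pos p i).1 = 0 := by
    rw [hstep] at hf2
    rcases hp : p[i]'(by omega) <;> rw [hp] at hf2 <;> simp [Step.vec] at hf2 ⊢ <;> omega
  refine ⟨i, by omega, fun j hj => hmin j (by omega), hright.1, ?_⟩
  have hts : IsThreeSided (p.take i) := by
    have := h1
    rw [← List.take_append_drop i p] at this
    exact this.of_append
  obtain ⟨σ, hσ⟩ := exists_run hts fun v hv => by
    obtain ⟨j, hj, rfl⟩ := (visited_take p (by omega)).1 hv
    exact hmin j (by omega)
  obtain ⟨hv, hw⟩ := run_eq_some hσ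
  obtain ⟨-, hp, hI⟩ := run_spec hσ
  rw [pos_take_length p (by omega)] at hp
  have hx := hright.2
  rw [hp] at hx
  rcases σ with ⟨c, r⟩ | ⟨c, r⟩ | ⟨o, l, d⟩
  · refine ⟨c, hv.1, ?_⟩
    simp only [point] at hx
    have : r = c.top - 1 := by omega
    rw [← hw, this]; rfl
  · have := hv.1.top_pos
    simp only [point] at hx
    omega
  -- A state on the left side of the box with x = 0 is a straight descent from the origin to (0,
  -- -d). Crossing there would visit (1, -d), towards which the final down step from (1, 1) would
  -- then point.
  · exfalso
    have hd : pos p i = (0, -(d : ℤ)) := by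
      rcases o with _ | c
      · rw [hp]
        simp only [point, sideX] at hx
        simp [point, sideX, sideY, hx]
      · have := (hv c rfl).top_pos
        simp only [point, sideX] at hx
        omega
    rw [hright.1, hd] at hstep
    simp [Step.vec] at hstep
    have hn : i + 1 ≠ p.length := by
      intro e
      rw [← e, Nat.add_sub_cancel, hd] at h3
      simp at h3
    have hlast := pos_succ (p := p) (i := p.length - 1) (by omega)
    rw [Nat.sub_add_cancel (by omega), h2, h3] at hlast
    have hdown : p[p.length - 1]'(by omega) = .down := by
      rcases hs : p[p.length - 1]'(by omega) <;> rw [hs] at hlast <;> simp [Step.vec] at hlast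
    refine h1.1 (p.length - 1) (by omega) (i + 1) (by omega) (1 + d) (by omega) ?_
    rw [hdown, h3, hstep]
    simp [Step.vec]

/-- The final descent of a generic polygon. -/
theorem IsGenericPolygon.exists_final_descent {p : List Step} (h : IsGenericPolygon p) :
    ∃ k, 1 ≤ k ∧ k < p.length ∧ (∀ j (hj : j < p.length), k ≤ j → p[j] = .down) ∧
      (∃ hk : k - 1 < p.length, p[k - 1] ≠ .down) ∧
      ∀ t, t ≤ p.length - k → pos p (p.length - t) = (1, (t : ℤ)) := by
  obtain ⟨h1, h2, h3⟩ := h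
  have hn : 0 < p.length := by
    by_contra h0
    rw [show p.length = 0 by omega, pos_zero] at h2
    simp at h2
  have hlast := pos_succ (p := p) (i := p.length - 1) (by omega)
  rw [Nat.sub_add_cancel (by omega), h2, h3] at hlast
  have hdown : p[p.length - 1]'(by omega) = .down := by
    rcases hs : p[p.length - 1]'(by omega) <;> rw [hs] at hlast <;> simp [Step.vec] at hlast
  have hex : ∃ k, k < p.length ∧ ∀ j (hj : j < p.length), k ≤ j → p[j] = .down :=
    ⟨p.length - 1, by omega, fun j hj hj' => by
      obtain rfl : j = p.length - 1 := by omega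
      exact hdown⟩
  have hpos : ∀ k, (∀ j (hj : j < p.length), k ≤ j → p[j] = .down) →
      ∀ t, t ≤ p.length - k → pos p (p.length - t) = (1, (t : ℤ)) := by
    intro k hk t ht
    induction t with
    | zero => simpa using h2
    | succ t ih =>
      have := pos_succ (p := p) (i := p.length - (t + 1)) (by omega)
      rw [show p.length - (t + 1) + 1 = p.length - t by omega, ih (by omega),
        hk _ _ (by omega)] at this
      simp only [Step.vec, Prod.ext_iff, Prod.fst_add, Prod.snd_add] at this ⊢
      push_cast
      omega
  classical
  obtain ⟨hf1, hf2⟩ := Nat.find_spec hex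
  have hf0 : 1 ≤ Nat.find hex := by
    by_contra h0
    have := hpos _ hf2 p.length (by omega)
    rw [Nat.sub_self, pos_zero] at this
    simp at this
  refine ⟨Nat.find hex, hf0, hf1, hf2, ⟨by omega, fun hd => ?_⟩, hpos _ hf2⟩
  refine Nat.find_min hex (m := Nat.find hex - 1) (by omega) ⟨by omega, fun j hj hj' => ?_⟩
  by_cases e : j = Nat.find hex - 1
  · subst e; exact hd
  · exact hf2 j hj (by omega)

/-- Step `i` crosses to x = 1 and the final descent starts at time `k`. The point is that `k = i +
1`: the walk goes down immediately after crossing. -/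
theorem IsGenericPolygon.exists_code {p : List Step} (h : IsGenericPolygon p) :
    ∃ c : Code, c.Valid ∧ p = c.polygon := by
  obtain ⟨i, hi, hneg, hpi, c, hc, htake⟩ := h.exists_crossing
  obtain ⟨k, hk1, hkn, hdown, ⟨hk', hnd⟩, hfin⟩ := h.exists_final_descent
  have hle : ∀ {j}, j ≤ p.length → (pos p j).1 ≤ 1 := fun hj => h.pos_fst_le hj
  obtain ⟨⟨h1, hside⟩, h2, h3⟩ := h
  obtain ⟨-, hq1, hq2⟩ := Code.leftPart_spec hc
  rw [← htake, pos_take_length p hi.le] at hq1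
  rw [← htake] at hq2
  have hstep := pos_succ hi
  rw [hpi, hq1] at hstep
  simp only [Step.vec, Prod.mk_add_mk, zero_add, add_zero] at hstep
  obtain ⟨y, hy, hyn⟩ : ∃ y : ℕ, y + k = p.length ∧ 1 ≤ y := ⟨p.length - k, by omega, by omega⟩
  have hposk : pos p k = (1, (y : ℤ)) := by
    have := hfin y (by omega)
    rwa [show p.length - y = k by omega] at this
  have hposk1 : pos p (k + 1) = (1, (y : ℤ) - 1) := by
    have := hfin (y - 1) (by omega)
    rw [show p.length - (y - 1) = k + 1 by omega] at this
    rw [this]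
    simp only [Prod.mk.injEq, true_and]
    omega
  have hstepk := pos_succ hk'
  rw [Nat.sub_add_cancel hk1, hposk] at hstepk
  -- The descent is entered by a right step: a left step would come from x = 2, and an up step from
  -- the vertex that the descent visits next.
  have hposk' : pos p (k - 1) = (0, (y : ℤ)) := by
    rcases hs : p[k - 1] <;> rw [hs] at hstepk hnd <;>
      simp only [Step.vec, Prod.ext_iff, Prod.fst_add, Prod.snd_add] at hstepk ⊢
    · have := hle (show k - 1 ≤ p.length by omega)
      omega
    · omega
    · refine (h1.pos_ne (show k - 1 < k + 1 by omega) (by omega) ?_).elim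
      rw [hposk1]
      exact Prod.ext (by simp only; omega) (by simp only; omega)
    · exact absurd rfl hnd
  have hki : i ≤ k - 1 := by
    by_contra hc
    have := hneg k (by omega)
    rw [hposk] at this
    simp at this
  have hk : k = i + 1 := by
    by_contra hne
    have hpk : p[k] = .down := hdown k hkn le_rfl
    -- Otherwise the descent would start at the crossing vertex, a repeated visit, or above it and
    -- point towards it.
    have hlt : (y : ℤ) < c.height := by
      by_contra hge
      rcases eq_or_lt_of_le (not_lt.1 hge) with e | e
      · refine h1.pos_ne (show i + 1 < k by omega) (by omega) ?_
        rw [hstep, hposk, e]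
      · refine h1 k hkn (i + 1) (by omega) (y - c.height : ℤ).toNat (by omega) ?_
        rw [hpk, hposk, hstep]
        simp [Step.vec]
        omega
    -- The vertex (0, y) must lie on a side of its box. The crossing vertex is higher and further
    -- right, so the left side remains; but the walk before the crossing has a vertex at level y
    -- with abscissa at most 0, hence (0, y) itself is visited twice.
    have hs := (hside (k - 2) (by omega)).1
    rw [show k - 2 + 1 = k - 1 by omega] at hs
    rcases hs with hs | hs | hs
    · obtain ⟨a, ha⟩ := hq2.level _ hq2.origin y (by simp) hlt.le
      obtain ⟨j, hj, e⟩ := (visited_take p hi.le).1 ha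
      have ha1 := hneg j hj
      have ha2 := hs j (by omega)
      rw [hposk', e] at ha2
      rw [e] at ha1
      refine h1.pos_ne (show j < k - 1 by omega) (by omega) ?_
      rw [e, hposk']
      exact Prod.ext (by simp only at ha1 ha2 ⊢; omega) rfl
    · have := hs (i + 1) (by omega)
      rw [hstep, hposk'] at this
      simp only at this; omega
    · have := hs (i + 1) (by omega)
      rw [hstep, hposk'] at this
      simp only at this; omega
  subst hk
  refine ⟨c, hc, ?_⟩
  have hyc : y = c.height := by
    rw [hposk] at hstep
    simpa using hstep
  have hdrop : p.drop (i + 1) = List.replicate c.height .down := by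
    rw [List.eq_replicate_iff]
    refine ⟨by rw [List.length_drop]; omega, fun s hs => ?_⟩
    obtain ⟨j, hj, rfl⟩ := List.getElem_of_mem hs
    rw [List.getElem_drop]
    exact hdown _ _ (by omega)
  rw [Code.polygon_eq hc, ← hdrop, ← htake, ← hpi, List.take_concat_get', List.take_append_drop]

theorem isGenericPolygon_iff (p : List Step) :
    IsGenericPolygon p ↔ ∃ c : Code, c.Valid ∧ c.polygon = p := by
  constructor
  · intro h
    obtain ⟨c, hc, rfl⟩ := h.exists_code
    exact ⟨c, hc, rfl⟩
  · rintro ⟨c, hc, rfl⟩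
    exact Code.isGenericPolygon_polygon hc

theorem genericPolygons_eq (n i j : ℕ) :
    genericPolygons n i j = Code.polygon '' {c | c.Valid ∧ c.half = n ∧ c.top = i ∧ c.gap = j} := by
  ext p
  simp only [genericPolygons, Set.mem_ofPred_eq, Set.mem_image, isGenericPolygon_iff]
  constructor
  · rintro ⟨⟨c, hc, rfl⟩, h1, h2, h3⟩
    rw [Code.hasHalfPerimeter_polygon hc] at h1
    rw [Code.topRowLength_polygon hc] at h2
    rw [Code.hasTopGap_polygon hc] at h3
    exact ⟨c, ⟨hc, h1, h2, h3⟩, rfl⟩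
  · rintro ⟨c, ⟨hc, h1, h2, h3⟩, rfl⟩
    rw [Code.hasHalfPerimeter_polygon hc, Code.topRowLength_polygon hc, Code.hasTopGap_polygon hc]
    exact ⟨⟨c, hc, rfl⟩, h1, h2, h3⟩

theorem genericPolygonsOfWidth_eq (n m : ℕ) :
    genericPolygonsOfWidth n m =
      Code.polygon '' {c | c.Valid ∧ c.half = n ∧ c.top + c.gap = m} := by
  ext p
  simp only [genericPolygonsOfWidth, Set.mem_ofPred_eq, Set.mem_image, isGenericPolygon_iff]
  constructor
  · rintro ⟨⟨c, hc, rfl⟩, h1, h2⟩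
    rw [Code.hasHalfPerimeter_polygon hc] at h1
    rw [Code.xMax_polygon hc, Code.xMin_polygon hc] at h2
    exact ⟨c, ⟨hc, h1, by omega⟩, rfl⟩
  · rintro ⟨c, ⟨hc, h1, h2⟩, rfl⟩
    rw [Code.hasHalfPerimeter_polygon hc, Code.xMax_polygon hc, Code.xMin_polygon hc]
    exact ⟨⟨c, hc, rfl⟩, h1, by omega⟩

noncomputable section

open scoped MvPowerSeries.WithPiTopology

attribute [local instance] discreteUniformSpace discreteTopologicalSpace discreteUniformity

/-! ### The generating function of generic polygons -/

/-- The codes of generic polygons. -/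
abbrev ValidCode := {c : Code // c.Valid}

/-- Codes inject into walks, and a bounded half-perimeter bounds the length of the walk. -/
theorem finiteLevels_half : FiniteLevels fun c : ValidCode => c.1.half := by
  intro n
  have hinj : Function.Injective fun c : ValidCode => c.1.polygon := fun c c' h =>
    Subtype.ext (Code.polygon_injOn c.2 c'.2 h)
  refine ((List.finite_length_lt Step (2 * n)).preimage hinj.injOn).subset fun c hc => ?_
  have := (Code.hasHalfPerimeter_polygon c.2 _).2 rfl
  simp only [HasHalfPerimeter, Set.mem_ofPred_eq, Set.mem_preimage] at this hc ⊢
  omega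

theorem ncard_polygon_image (P : Code → Prop) :
    (Code.polygon '' {c | c.Valid ∧ P c}).ncard = {c : ValidCode | P c.1}.ncard := by
  rw [(Code.polygon_injOn.mono fun c hc => hc.1).ncard_image,
    ← Set.ncard_image_of_injective _ Subtype.val_injective]
  congr 1
  ext c
  simp [and_comm]

theorem hasSum_R :
    HasSum (fun c : ValidCode => (T ^ c.1.half * U ^ c.1.top * W ^ c.1.gap : Series)) R := by
  refine hasSum_gf finiteLevels_half fun d => ?_
  have : MvPowerSeries.coeff d R = ((genericPolygons (d 0) (d 1) (d 2)).ncard : ℚ) := rfl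
  rw [this, genericPolygons_eq, ncard_polygon_image]

theorem hasSum_widthGF :
    HasSum (fun c : ValidCode => (T ^ c.1.half * U ^ 0 * W ^ (c.1.top + c.1.gap) : Series))
      widthGF := by
  refine hasSum_gf finiteLevels_half fun d => ?_
  have : MvPowerSeries.coeff d widthGF =
    if d 1 = 0 then ((genericPolygonsOfWidth (d 0) (d 2)).ncard : ℚ) else 0 := rfl
  rw [this, genericPolygonsOfWidth_eq, ncard_polygon_image]
  split_ifs with h
  · simp [h]
  · have : {c : ValidCode | c.1.half = d 0 ∧ 0 = d 1 ∧ c.1.top + c.1.gap = d 2} = ∅ := by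
      ext c; simp [Ne.symm h]
    rw [this]; simp

theorem constantCoeff_W : MvPowerSeries.constantCoeff W = 0 := MvPowerSeries.constantCoeff_X 2

theorem constantCoeff_U : MvPowerSeries.constantCoeff U = 0 := MvPowerSeries.constantCoeff_X 1

theorem constantCoeff_UT : MvPowerSeries.constantCoeff (U * T) = 0 := by
  rw [map_mul, constantCoeff_U, zero_mul]

/-- The width of the polygon is `top + gap`, so equating u and w merges the two exponents into it.
-/
theorem evalUW_R_W_W : evalUW R W W = widthGF := by
  refine (hasSum_evalUW constantCoeff_W constantCoeff_W hasSum_R).unique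
    (hasSum_of_eq hasSum_widthGF fun c => ?_)
  ring

/-- Decomposition of a code according to its last piece. -/
def codeOfPieces : (List ℕ ⊕ (c : ValidCode) × Fin c.1.top) ⊕
    ((c : ValidCode) × Fin c.1.gap) ⊕ (ValidCode × List ℕ) → ValidCode
  | .inl (.inl l) => ⟨.base l, trivial⟩
  | .inl (.inr ⟨c, r⟩) => ⟨.right c.1 r, c.2, r.2⟩
  | .inr (.inl ⟨c, r⟩) => ⟨.left c.1 r, c.2, r.2⟩
  | .inr (.inr ⟨c, l⟩) => ⟨.beyond c.1 l, c.2⟩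

theorem codeOfPieces_bijective : Function.Bijective codeOfPieces := by
  constructor
  · rintro ((l | ⟨⟨c, hc⟩, r⟩) | (⟨⟨c, hc⟩, r⟩ | ⟨⟨c, hc⟩, l⟩))
      ((l' | ⟨⟨c', hc'⟩, r'⟩) | (⟨⟨c', hc'⟩, r'⟩ | ⟨⟨c', hc'⟩, l'⟩)) h <;>
      replace h := congrArg Subtype.val h <;>
      simp only [codeOfPieces, Code.base.injEq, Code.right.injEq,
        Code.left.injEq, Code.beyond.injEq, reduceCtorEq] at h
    · rw [h]
    · obtain ⟨rfl, h⟩ := h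
      rw [Fin.ext h]
    · obtain ⟨rfl, h⟩ := h
      rw [Fin.ext h]
    · obtain ⟨rfl, rfl⟩ := h
      rfl
  · rintro ⟨l | ⟨c, l⟩ | ⟨c, r⟩ | ⟨c, r⟩, h⟩
    · exact ⟨.inl (.inl l), rfl⟩
    · exact ⟨.inr (.inr ⟨⟨c, h⟩, l⟩), rfl⟩
    · exact ⟨.inl (.inr ⟨⟨c, h.1⟩, ⟨r, h.2⟩⟩), rfl⟩
    · exact ⟨.inr (.inl ⟨⟨c, h.1⟩, ⟨r, h.2⟩⟩), rfl⟩

/-- `P` and `Q` are generating functions of pairs of a code and an admissible horizontal move inside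
the box, to the right and to the left respectively. The geometric sum over the moves of a fixed code
turns them into the two quotients. -/
theorem functionalEquation_R : FunctionalEquation R := by
  have hWW := hasSum_evalUW constantCoeff_W constantCoeff_W hasSum_R
  have hUT := hasSum_evalUW constantCoeff_U constantCoeff_UT hasSum_R
  obtain ⟨P, hP⟩ := summable_gf
    (i := fun x : (c : ValidCode) × Fin c.1.top => x.1.1.half)
    (fun x => x.1.1.top - 1 - x.2) (fun x => x.1.1.gap + x.2)
    (finiteLevels_half.sigma_fin fun c => c.1.top)
  obtain ⟨Q, hQ⟩ := summable_gf
    (i := fun x : (c : ValidCode) × Fin c.1.gap => x.1.1.half + x.2)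
    (fun x => x.1.1.top + x.2) (fun x => x.1.1.gap - 1 - x.2)
    ((finiteLevels_half.sigma_fin fun c => c.1.gap).mono fun x => Nat.le_add_right _ _)
  refine ⟨P, Q, ?_, ?_, ?_⟩
  · refine ((hasSum_sigma_fin hP).mul_left (W - U)).unique
      (hasSum_of_eq (hWW.sub hasSum_R) fun c => ?_)
    have hg := geom_sum₂_mul (W : Series) U c.1.top
    rw [← Fin.sum_univ_eq_sum_range (fun r => (W ^ r * U ^ (c.1.top - 1 - r) : Series))] at hg
    have : ∑ r : Fin c.1.top,
        (T ^ c.1.half * U ^ (c.1.top - 1 - r) * W ^ (c.1.gap + r) : Series) =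
        T ^ c.1.half * W ^ c.1.gap * ∑ r : Fin c.1.top, W ^ (r : ℕ) * U ^ (c.1.top - 1 - r) := by
      rw [Finset.mul_sum]
      exact Finset.sum_congr rfl fun r _ => by ring
    rw [this]
    linear_combination (T ^ c.1.half * W ^ c.1.gap) * hg
  · refine ((hasSum_sigma_fin hQ).mul_left (W - U * T)).unique
      (hasSum_of_eq (hasSum_R.sub hUT) fun c => ?_)
    have hg := geom_sum₂_mul (U * T : Series) W c.1.gap
    rw [← Fin.sum_univ_eq_sum_range
      (fun r => ((U * T) ^ r * W ^ (c.1.gap - 1 - r) : Series))] at hg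
    have : ∑ r : Fin c.1.gap,
        (T ^ (c.1.half + r) * U ^ (c.1.top + r) * W ^ (c.1.gap - 1 - r) : Series) =
        T ^ c.1.half * U ^ c.1.top *
          ∑ r : Fin c.1.gap, (U * T) ^ (r : ℕ) * W ^ (c.1.gap - 1 - r) := by
      rw [Finset.mul_sum]
      exact Finset.sum_congr rfl fun r _ => by ring
    rw [this]
    linear_combination (-T ^ c.1.half * U ^ c.1.top) * hg
  · have hprod := hasSum_prod hUT hasSum_B_add_T (by
      have hfin := finiteLevels_half.prod
        (finiteLevels_barSize.mono (j := fun l => barSize l + 1) fun l => Nat.le_succ _)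
      -- Setting w = ut moves the gap into the exponents of both t and u: these are the steps that
      -- bring the walk to the left side of the box.
      refine (summable_gf (fun x => x.1.1.top + x.1.1.gap + x.2.length) (fun _ => 0)
        (hfin.mono (j := fun x => x.1.1.half + (barSize x.2 + 1) + x.1.1.gap)
          fun x => Nat.le_add_right _ _)).congr fun x => ?_
      ring)
    have hpieces : HasSum (fun x =>
        (T ^ (codeOfPieces x).1.half * U ^ (codeOfPieces x).1.top *
          W ^ (codeOfPieces x).1.gap : Series))
        ((U * T * (B + T) + U * T * P) +
          (U * T ^ 2 * Q + U * T * (evalUW R U (U * T) * (B + T)))) := by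
      refine hasSum_sum_type (hasSum_sum_type ?_ ?_) (hasSum_sum_type ?_ ?_)
      · refine hasSum_of_eq (hasSum_B_add_T.mul_left (U * T)) fun l => ?_
        simp only [codeOfPieces, Code.half, Code.top_base, Code.gap_base]
        ring
      · refine hasSum_of_eq (hP.mul_left (U * T)) ?_
        rintro ⟨c, r⟩
        have : c.1.top - (r : ℕ) = c.1.top - 1 - r + 1 := by omega
        simp only [codeOfPieces, Code.half, Code.top_right, Code.gap_right, this]
        ring
      · refine hasSum_of_eq (hQ.mul_left (U * T ^ 2)) ?_
        rintro ⟨c, r⟩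
        have : c.1.gap - ((r : ℕ) + 1) = c.1.gap - 1 - r := by omega
        simp only [codeOfPieces, Code.half, Code.top_left, Code.gap_left, this]
        ring
      · refine hasSum_of_eq (hprod.mul_left (U * T)) ?_
        rintro ⟨c, l⟩
        simp only [codeOfPieces, Code.half, Code.top_beyond, Code.gap_beyond]
        ring
    have hR := ((Equiv.ofBijective _ codeOfPieces_bijective).hasSum_iff.2 hasSum_R).unique hpieces
    exact hR.trans (by ring)

theorem finite_coeff_R (n : ℕ) :
    {d : Fin 3 →₀ ℕ | d 0 = n ∧ MvPowerSeries.coeff d R ≠ 0}.Finite := by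
  refine ((finiteLevels_half n).image fun c : ValidCode =>
    (Finsupp.single 0 c.1.half + Finsupp.single 1 c.1.top + Finsupp.single 2 c.1.gap :
      Fin 3 →₀ ℕ)).subset ?_
  rintro d ⟨rfl, hd⟩
  have : MvPowerSeries.coeff d R = ((genericPolygons (d 0) (d 1) (d 2)).ncard : ℚ) := rfl
  rw [this, genericPolygons_eq, ncard_polygon_image, Nat.cast_ne_zero] at hd
  obtain ⟨c, h1, h2, h3⟩ := Set.nonempty_of_ncard_ne_zero hd
  refine ⟨c, h1.le, ?_⟩
  ext i
  fin_cases i <;> simp [h1, h2, h3]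

/-! ### Uniqueness of the solution -/

theorem T_dvd_iff {f : Series} : T ∣ f ↔ ∀ d : Fin 3 →₀ ℕ, d 0 = 0 → MvPowerSeries.coeff d f = 0 :=
  MvPowerSeries.X_dvd_iff

/-- Setting t = 0, here the map `r`, sends a product divisible by t to a vanishing product, and the
power series ring has no zero divisors. -/
theorem T_dvd_or_dvd {f g : Series} (h : T ∣ f * g) : T ∣ f ∨ T ∣ g := by
  let r : Series → Series := fun f d => if d 0 = 0 then MvPowerSeries.coeff d f else 0
  have hr : ∀ f d, MvPowerSeries.coeff d (r f) = if d 0 = 0 then MvPowerSeries.coeff d f else 0 :=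
    fun _ _ => rfl
  have hr0 : ∀ f, r f = 0 → T ∣ f := fun f hf => T_dvd_iff.2 fun d hd => by
    have := hr f d
    rw [hf, if_pos hd, map_zero] at this
    exact this.symm
  have hmul : r f * r g = 0 := by
    ext d
    rw [MvPowerSeries.coeff_mul, map_zero]
    by_cases hd : d 0 = 0
    · have := T_dvd_iff.1 h d hd
      rw [MvPowerSeries.coeff_mul] at this
      rw [← this]
      refine Finset.sum_congr rfl fun x hx => ?_
      have hx' := congrArg (fun e : Fin 3 →₀ ℕ => e 0) (Finset.HasAntidiagonal.mem_antidiagonal.1 hx)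
      simp only [Finsupp.add_apply, hd] at hx'
      rw [hr, hr, if_pos (by omega), if_pos (by omega)]
    · refine Finset.sum_eq_zero fun x hx => ?_
      have hx' := congrArg (fun e : Fin 3 →₀ ℕ => e 0) (Finset.HasAntidiagonal.mem_antidiagonal.1 hx)
      simp only [Finsupp.add_apply] at hx'
      rw [hr, hr]
      by_cases h1 : x.1 0 = 0
      · rw [if_neg (show ¬x.2 0 = 0 by omega), mul_zero]
      · rw [if_neg h1, zero_mul]
  exact (mul_eq_zero.1 hmul).imp (hr0 f) (hr0 g)

theorem T_ne_zero : (T : Series) ≠ 0 := fun h => by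
  have := congrArg (MvPowerSeries.coeff (Finsupp.single 0 1)) h
  simp [MvPowerSeries.coeff_X] at this

theorem T_pow_dvd_of_dvd_mul {f g : Series} (hf : ¬ T ∣ f) (n : ℕ) (h : T ^ n ∣ f * g) :
    T ^ n ∣ g := by
  have hp : Prime (T : Series) := by
    refine ⟨T_ne_zero, fun hu => ?_, fun _ _ => T_dvd_or_dvd⟩
    have := hu.map (MvPowerSeries.constantCoeff (σ := Fin 3) (R := ℚ))
    simp at this
  exact hp.pow_dvd_of_dvd_mul_left n hf h

theorem not_T_dvd_W_sub {a : Series} (ha : MvPowerSeries.coeff (Finsupp.single 2 1) a = 0) :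
    ¬ T ∣ W - a := by
  intro h
  have := T_dvd_iff.1 h (Finsupp.single 2 1) (by simp)
  rw [map_sub, ha] at this
  simp [MvPowerSeries.coeff_X] at this

theorem evalUW_sub {a b : Series} (ha : MvPowerSeries.constantCoeff a = 0)
    (hb : MvPowerSeries.constantCoeff b = 0) (F G : Series) :
    evalUW (F - G) a b = evalUW F a b - evalUW G a b := by
  simp only [← evalHom_apply ha hb, map_sub]

theorem evalUW_add {a b : Series} (ha : MvPowerSeries.constantCoeff a = 0)
    (hb : MvPowerSeries.constantCoeff b = 0) (F G : Series) :
    evalUW (F + G) a b = evalUW F a b + evalUW G a b := by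
  simp only [← evalHom_apply ha hb, map_add]

theorem T_pow_dvd_evalUW {a b : Series} (ha : MvPowerSeries.constantCoeff a = 0)
    (hb : MvPowerSeries.constantCoeff b = 0) {F : Series} {n : ℕ} (h : T ^ n ∣ F) :
    T ^ n ∣ evalUW F a b := by
  have := map_dvd (evalHom ha hb) h
  rwa [map_pow, evalHom_apply, evalHom_apply, evalUW_T ha hb] at this

/-- The equation is contracting in the t-adic sense. As t is prime and divides neither w - u nor w -
ut, the quotients are congruent modulo the same power of t as the solutions, and the outer factor t
gains one more. -/
theorem FunctionalEquation.unique {F G : Series} (hF : FunctionalEquation F)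
    (hG : FunctionalEquation G) : F = G := by
  obtain ⟨P, Q, hP, hQ, hF⟩ := hF
  obtain ⟨P', Q', hP', hQ', hG⟩ := hG
  have hW := constantCoeff_W
  have hUT := constantCoeff_UT
  have key : ∀ n : ℕ, T ^ n ∣ F - G := by
    intro n
    induction n with
    | zero => simp
    | succ n ih =>
      have h1 : T ^ n ∣ P - P' := by
        refine T_pow_dvd_of_dvd_mul (f := W - U) (not_T_dvd_W_sub ?_) n ?_
        · rw [MvPowerSeries.coeff_X, if_neg]
          intro h
          simpa using congrArg (fun e : Fin 3 →₀ ℕ => e 1) h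
        · have : (W - U) * (P - P') = evalUW (F - G) W W - (F - G) := by
            rw [evalUW_sub hW hW]
            linear_combination hP - hP'
          rw [this]
          exact dvd_sub (T_pow_dvd_evalUW hW hW ih) ih
      have h2 := T_pow_dvd_evalUW constantCoeff_U hUT ih
      have h3 : T ^ n ∣ Q - Q' := by
        refine T_pow_dvd_of_dvd_mul (f := W - U * T) (not_T_dvd_W_sub ?_) n ?_
        · exact T_dvd_iff.1 (Dvd.intro_left U rfl) _ (by simp)
        · have : (W - U * T) * (Q - Q') = (F - G) - evalUW (F - G) U (U * T) := by
            rw [evalUW_sub constantCoeff_U hUT]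
            linear_combination hQ - hQ'
          rw [this]
          exact dvd_sub ih h2
      have : F - G = T * (U * (P - P') + U * T * (Q - Q') +
          evalUW (F - G) U (U * T) * (U * (B + T))) := by
        rw [evalUW_sub constantCoeff_U hUT]
        linear_combination hF - hG
      rw [this, pow_succ']
      exact mul_dvd_mul_left T
        (dvd_add (dvd_add (h1.mul_left _) (h3.mul_left _)) (h2.mul_right _))
  rw [← sub_eq_zero]
  ext d
  exact MvPowerSeries.X_pow_dvd_iff.1 (key (d 0 + 1)) d (Nat.lt_succ_self _)

/-! ### The kernel method -/

theorem evalUW_B_congr {a b c : Series} (ha : MvPowerSeries.constantCoeff a = 0)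
    (hb : MvPowerSeries.constantCoeff b = 0) (hc : MvPowerSeries.constantCoeff c = 0) :
    evalUW B a b = evalUW B a c := by
  have h1 := hasSum_evalUW ha hb hasSum_B_add_T
  have h2 := hasSum_evalUW ha hc hasSum_B_add_T
  have := h1.unique (hasSum_of_eq h2 fun l => by simp)
  rwa [evalUW_add ha hb, evalUW_add ha hc, evalUW_T ha hb, evalUW_T ha hc,
    add_left_inj] at this

/-- The functional equation of `R` on the zero set of its kernel. -/
theorem kernel_equation {a b : Series} (ha : MvPowerSeries.constantCoeff a = 0)
    (hb : MvPowerSeries.constantCoeff b = 0)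
    (hker : b ^ 2 - a * b * (1 + T ^ 2) + a ^ 2 * T = 0) :
    a * T * (evalUW B a W + T) * (1 + evalUW R a (a * T)) * (b - a) * (b - a * T) +
      a * T * evalUW R b b * (b - a * T) - a * T ^ 2 * evalUW R a (a * T) * (b - a) = 0 := by
  obtain ⟨P, Q, hP, hQ, hR⟩ := functionalEquation_R
  have hP := congrArg (evalHom ha hb) hP
  have hQ := congrArg (evalHom ha hb) hQ
  have hR := congrArg (evalHom ha hb) hR
  have hUT := constantCoeff_UT
  have eUT : evalUW (U * T) a b = a * T := by
    rw [← evalHom_apply ha hb, map_mul, evalHom_apply, evalHom_apply, evalUW_U ha hb,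
      evalUW_T ha hb]
  simp only [map_mul, map_sub, map_add, map_pow, evalHom_apply, evalUW_T ha hb, evalUW_U ha hb,
    evalUW_W ha hb, evalUW_evalUW constantCoeff_W constantCoeff_W ha hb,
    evalUW_evalUW constantCoeff_U hUT ha hb, eUT, evalUW_B_congr ha hb constantCoeff_W] at hP hQ hR
  -- Clearing both denominators gives `evalUW R a b` the kernel as its coefficient, which vanishes
  -- by `hker`.
  linear_combination (-(b - a) * (b - a * T)) * hR - a * T * (b - a * T) * hP
    - a * T ^ 2 * (b - a) * hQ + evalUW R a b * hker

/-- For u = qx the kernel is quadratic in w with roots x and tq²x. Both specialisations contain the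
unknown R(t, qx, tqx), called `G` below, which is eliminated. -/
theorem recurrence_numerators {q x : Series} (hq : T * q ^ 2 - (1 + T ^ 2) * q + 1 = 0)
    (hx : MvPowerSeries.constantCoeff x = 0) (hx0 : x ≠ 0) :
    evalUW R x x * denom q x =
      (1 + T ^ 2 - (1 - 2 * T + 2 * T ^ 2 + T ^ 4) * q) * (Bq q x + T) * x +
      ((1 - T) * q - 1 - ((1 - T + T ^ 2) * q - 1) * (Bq q x + T) * x) *
        evalUW R (T * q ^ 2 * x) (T * q ^ 2 * x) := by
  have hqx : MvPowerSeries.constantCoeff (q * x) = 0 := by rw [map_mul, hx, mul_zero]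
  have hy : MvPowerSeries.constantCoeff (T * q ^ 2 * x) = 0 := by rw [map_mul, hx, mul_zero]
  have hT := T_ne_zero
  have hq0 : q ≠ 0 := by
    rintro rfl
    simp at hq
  have h1qT : (1 - q * T : Series) ≠ 0 := by
    intro h
    have := congrArg (MvPowerSeries.constantCoeff (σ := Fin 3) (R := ℚ)) h
    simp at this
  have h1T : (1 - T : Series) ≠ 0 := by
    intro h
    have := congrArg (MvPowerSeries.constantCoeff (σ := Fin 3) (R := ℚ)) h
    simp at this
  have k1 := kernel_equation hqx hx (by linear_combination x ^ 2 * hq)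
  have k2 := kernel_equation hqx hy (by linear_combination q ^ 2 * x ^ 2 * T * hq)
  change _ * (Bq q x + T) * _ * _ * _ + _ - _ = _ at k1 k2
  rw [denom]
  generalize evalUW R (q * x) (q * x * T) = G at k1 k2
  generalize evalUW R x x = H at k1 ⊢
  generalize evalUW R (T * q ^ 2 * x) (T * q ^ 2 * x) = M at k2 ⊢
  generalize hb : (Bq q x + T) * x = b
  have e1 : b * ((1 - q) * (1 - q * T)) * (1 + G) + H * (1 - q * T) - T * (1 - q) * G = 0 := by
    have h0 : q * T * x ^ 2 ≠ 0 := mul_ne_zero (mul_ne_zero hq0 hT) (pow_ne_zero _ hx0)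
    refine (mul_eq_zero.1 ?_).resolve_left h0
    rw [← hb]
    linear_combination k1
  have e2 : b * ((1 - q) * (1 - q * T)) * q * (1 + G) - M * (1 - q) + (1 - T * q) * G = 0 := by
    have h0 : q ^ 2 * T ^ 2 * x ^ 2 ≠ 0 :=
      mul_ne_zero (mul_ne_zero (pow_ne_zero _ hq0) (pow_ne_zero _ hT)) (pow_ne_zero _ hx0)
    refine (mul_eq_zero.1 ?_).resolve_left h0
    rw [← hb]
    linear_combination k2
  -- Cross-multiplying `e1` and `e2` by their coefficients of `G` eliminates `G`. Reduction by the
  -- quadratic equation of q leaves the claim times 1 - t.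
  refine mul_left_cancel₀ h1T ?_
  simp only [mul_assoc _ (Bq q x + T) x, hb]
  linear_combination (b * ((1 - q) * (1 - q * T)) * q + 1 - T * q) * e1 -
    (b * ((1 - q) * (1 - q * T)) - T * (1 - q)) * e2 -
    (-M + 2 * b + 2 * b * M - q * b * M + q * b * H + T * H - T * b - T * b * M + T * q * b +
      T * q * b * H - T * q ^ 2 * b - T * q ^ 2 * b * H + T ^ 2 * b + T ^ 2 * b * H -
      T ^ 2 * q * b - T ^ 2 * q * b * H - T ^ 3 * b - T ^ 3 * b * H) * hq

theorem constantCoeff_denom (q x : Series) (hx : MvPowerSeries.constantCoeff x = 0) :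
    MvPowerSeries.constantCoeff (denom q x) = 1 := by
  simp [denom, hx]

/-- The functional equation `H(x) = L(x) + K(x) H(t q² x)` for `H(x) = R(t, x, x)`. -/
theorem recurrence {q x : Series} (hq : T * q ^ 2 - (1 + T ^ 2) * q + 1 = 0)
    (hx : MvPowerSeries.constantCoeff x = 0) (hx0 : x ≠ 0) :
    evalUW R x x = L q x + K q x * evalUW R (T * q ^ 2 * x) (T * q ^ 2 * x) := by
  have h := recurrence_numerators hq hx hx0
  have hd : denom q x * (denom q x)⁻¹ = 1 :=
    MvPowerSeries.mul_inv_cancel _ (by rw [constantCoeff_denom q x hx]; exact one_ne_zero)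
  rw [L, K]
  linear_combination (denom q x)⁻¹ * h - evalUW R x x * hd

/-- The equation of q gives q - 1 = t(q² - tq), and modulo t both coefficients in the numerator of K
reduce to q - 1. -/
theorem T_dvd_K {q : Series} (x : Series) (hq : T * q ^ 2 - (1 + T ^ 2) * q + 1 = 0) :
    T ∣ K q x := by
  refine Dvd.dvd.mul_right ⟨(q ^ 2 - T * q) - q -
    ((q ^ 2 - T * q) - q + T * q) * ((Bq q x + T) * x), ?_⟩ _
  linear_combination (-1 + (Bq q x + T) * x) * hq

theorem isFormalSum_R {q : Series} (hq : T * q ^ 2 - (1 + T ^ 2) * q + 1 = 0) :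
    IsFormalSum (fun k => L q ((T * q ^ 2) ^ k * W) *
      ∏ j ∈ Finset.range k, K q ((T * q ^ 2) ^ j * W)) (evalUW R W W) := by
  have hq0 : q ≠ 0 := by
    rintro rfl
    simp at hq
  have hx : ∀ k, MvPowerSeries.constantCoeff ((T * q ^ 2) ^ k * W) = 0 := fun k => by
    rw [map_mul, constantCoeff_W, mul_zero]
  have hW0 : (W : Series) ≠ 0 := fun h => by
    have := congrArg (MvPowerSeries.coeff (Finsupp.single 2 1)) h
    simp [MvPowerSeries.coeff_X] at this
  have hx0 : ∀ k, (T * q ^ 2) ^ k * W ≠ 0 := fun k =>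
    mul_ne_zero (pow_ne_zero _ (mul_ne_zero T_ne_zero (pow_ne_zero _ hq0))) hW0
  -- Iterating the recurrence `m` times leaves a remainder with `m` factors K, hence divisible by
  -- the `m`-th power of t.
  have hsum : ∀ m, evalUW R W W = ∑ k ∈ Finset.range m, L q ((T * q ^ 2) ^ k * W) *
      ∏ j ∈ Finset.range k, K q ((T * q ^ 2) ^ j * W) +
      (∏ j ∈ Finset.range m, K q ((T * q ^ 2) ^ j * W)) *
        evalUW R ((T * q ^ 2) ^ m * W) ((T * q ^ 2) ^ m * W) := by
    intro m
    induction m with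
    | zero => simp
    | succ m ih =>
      have h := recurrence hq (hx m) (hx0 m)
      rw [← mul_assoc, ← pow_succ'] at h
      rw [ih, Finset.sum_range_succ, Finset.prod_range_succ]
      linear_combination (∏ j ∈ Finset.range m, K q ((T * q ^ 2) ^ j * W)) * h
  intro N
  refine ⟨N, fun m hm => ?_⟩
  rw [hsum m, add_sub_cancel_left]
  refine Dvd.dvd.mul_right ((pow_dvd_pow T hm).trans ?_) _
  have := Finset.prod_dvd_prod_of_dvd (fun _ : ℕ => (T : Series))
    (fun j => K q ((T * q ^ 2) ^ j * W)) (s := Finset.range m) fun j _ => T_dvd_K _ hq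
  simpa using this

/-! ### The series `q` -/

theorem exists_catalan (x : Series) (hx : MvPowerSeries.constantCoeff x = 0) :
    ∃ c : Series, c = 1 + x * c ^ 2 := by
  have hs : PowerSeries.HasSubst x := PowerSeries.HasSubst.of_constantCoeff_zero hx
  let c := PowerSeries.catalanSeries.map (Nat.castRingHom ℚ)
  have h : c ^ 2 * PowerSeries.X + 1 = c := by
    have := congrArg (PowerSeries.map (Nat.castRingHom ℚ))
      PowerSeries.catalanSeries_sq_mul_X_add_one
    simpa using this
  refine ⟨PowerSeries.substAlgHom hs c, ?_⟩
  have := congrArg (PowerSeries.substAlgHom hs) h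
  rw [map_add, map_mul, map_pow, map_one, PowerSeries.substAlgHom_X] at this
  linear_combination -this

/-- With r = 1/(1+t²) and q = rc, the quadratic equation of q becomes the Catalan equation c = 1 +
tr²c². The square root is then found by completing the square. -/
theorem exists_isQ : ∃ q : Series, IsQ q ∧ T * q ^ 2 - (1 + T ^ 2) * q + 1 = 0 := by
  have hinv : (1 + T ^ 2 : Series) * (1 + T ^ 2 : Series)⁻¹ = 1 :=
    MvPowerSeries.mul_inv_cancel _ (by simp)
  obtain ⟨c, hc⟩ := exists_catalan (T * ((1 + T ^ 2 : Series)⁻¹) ^ 2) (by simp)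
  generalize (1 + T ^ 2 : Series)⁻¹ = r at hinv hc
  have hq : T * (r * c) ^ 2 - (1 + T ^ 2) * (r * c) + 1 = 0 := by
    linear_combination -hc - c * hinv
  refine ⟨r * c, ⟨T ^ 2 + 1 - 2 * T * (r * c), ⟨?_, by simp⟩, by ring⟩, hq⟩
  linear_combination 4 * T * hq

end

end PrudentPolygons

open PrudentPolygons
theorem mainTheorem2 :
    -- the functional equation has exactly one power series solution, and it is the generating
    -- function `R` of generic three-sided prudent polygons, a power series in `t` whose
    -- coefficients are polynomials in `u` and `w`
    (∃! F : Series, FunctionalEquation F) ∧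
    FunctionalEquation R ∧
    (∀ n : ℕ, {d : Fin 3 →₀ ℕ |
      d 0 = n ∧ MvPowerSeries.coeff d R ≠ 0}.Finite) ∧
    -- `R(t, w, w)` counts these polygons by half-perimeter and width
    evalUW R W W =
      widthGF ∧
    -- the explicit form of the bar graph series
    (∃ s : Series,
      IsSqrt s
        (T ^ 2 * (1 - T) ^ 2 * U ^ 2
          - 2 * T * (1 - T ^ 2) * U
          + (1 - T) ^ 2) ∧
      2 * T * U * B =
        1 - T
          - U * (1 + T) * T - s) ∧
    -- the explicit formula for `R(t, w, w)`
    (∃ q : Series, IsQ q ∧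
      IsFormalSum
        (fun k => L q ((T * q ^ 2) ^ k * W) *
          ∏ j ∈ Finset.range k,
            K q ((T * q ^ 2) ^ j * W))
        (evalUW R W W)) := by
  obtain ⟨q, hq, hq'⟩ := exists_isQ
  exact ⟨⟨R, functionalEquation_R, fun F hF => hF.unique functionalEquation_R⟩,
    functionalEquation_R, finite_coeff_R, evalUW_R_W_W, exists_isSqrt_B, q, hq, isFormalSum_R hq'⟩
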